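/- Let $G$ be a finite abelian group, $\chi : G\times G\to\mathbb T=\{z\in\mathbb C:|z|=1\}$ a nondegenerate symmetric bicharacter and $\tau=\pm|G|^{-1/2}$. Put $\Omega=G\sqcup\{m\}$, $\Omega_g=\Omega$ for $g\in G$, and $\Omega_m=G\sqcup\overline G$, where $\overline G$ is a second copy of $G$. For $x\in\Omega$ let $H^x$ be the Hilbert space with orthonormal basis $v^x_\alpha$ $(\alpha\in\Omega_x)$. Let $\circ$ be the bilinear operation on $\bigoplus_x H^x$ whose only nonzero values on basis vectors are given by, for $g,h,k\in G$, $$v^g_k\circ v^h_{x}=\delta_{x,h+k}v^{g+h}_{h+k},\quad v^g_m\circ v^h_x=\delta_{x,m}v^{g+h}_m,\quad v^m_k\circ v^g_x=\delta_{x,m}\chi(g,k)v^m_k,\quad v^m_{\overline k}\circ v^g_x=\delta_{x,g+k}v^m_{\overline{g+k}},$$ $$v^g_x\circ v^m_{\overline k}=\delta_{x,m}\chi(g,k)v^m_{\overline k},\quad v^g_x\circ v^m_k=\delta_{x,k}v^m_{k-g},\quad v^m_h\circ v^m_{\overline k}=v^{k-h}_k,\quad v^m_{\overline h}\circ v^m_k=\delta_{h,k}\,\tau\sum_{g\in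 G}\chi(g,h)^{-1}v^g_m .$$ Let $\mathfrak G_{TY}$ be the weak Hopf $C^*$-algebra reconstructed from the Tambara–Yamagami category $\mathcal{TY}(G,\chi,\tau)$ and the Hayashi functor: its underlying space is $B=\bigoplus_{x\in\Omega}H^x\otimes\overline{H^x}$ with basis $f^x_{\alpha,\beta}=v^x_\alpha\otimes\overline{v^x_\beta}$; the product is $f^x_{\alpha,\beta}f^y_{\gamma,\delta}=\sum_z (v^x_\alpha\circ v^y_\gamma)_z\otimes\overline{(v^x_\beta\circ v^y_\delta)_z}$, where $(\cdot)_z$ is the component in $H^z$, with unit $\sum_{\alpha,\beta\in\Omega}f^0_{\alpha,\beta}$; the comultiplication and counit are $\Delta(f^x_{\alpha,\beta})=\sum_{\gamma\in\Omega_x}f^x_{\alpha,\gamma}\otimes f^x_{\gamma,\beta}$ and $\varepsilon(f^x_{\alpha,\beta})=\delta_{\alpha,\beta}$; the antipode $S$ (linear) and the involution (antilinear) are given, for $g,h\in G$, $\alpha,\beta\in\Omega$ and with $m-g=m$, by $$S(f^g_{\alpha,\beta})=f^{-g}_{\beta-g,\alpha-g},\ S(f^m_{g,h})=f^m_{\overline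 h,\overline g},\ S(f^m_{g,\overline h})=\tau^{-1}f^m_{h,\overline g},\ S(f^m_{\overline g,h})=\tau f^m_{\overline h,g},\ S(f^m_{\overline g,\overline h})=f^m_{h,g},$$ $$(f^g_{\alpha,\beta})^*=f^{-g}_{\alpha-g,\beta-g},\ (f^m_{g,h})^*=f^m_{\overline g,\overline h},\ (f^m_{g,\overline h})^*=\tau f^m_{\overline g,h},\ (f^m_{\overline g,h})^*=\tau^{-1}f^m_{g,\overline h},\ (f^m_{\overline g,\overline h})^*=f^m_{g,h}.$$ A coideal of $B$ is a unital $*$-subalgebra $I\subset B$ with $\Delta(I)\subset I\otimes B$. It is invariant if $I\triangleleft B=I$, where $b\triangleleft x=S(x_{(1)})\,b\,x_{(2)}$ and $I\triangleleft B$ is the linear span of the $b\triangleleft x$ with $b\in I$, $x\in B$. Coideals carry the operations $I\wedge J=I\cap J$ and $I\vee J=$ the unital $*$-subalgebra generated by $I\cup J$. As a $*$-algebra, $B=\bigoplus_{s\in G}M_\Omega(\mathbb C)\oplus M_{G\sqcup\overline G}(\mathbb C)$, with matrix units $e^s_{\alpha,\beta}$ of the blocks indexed by $G$ such that, for $p,i,k\in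 G$, $$f^p_{i,k}=e^{i-k}_{p-k,-k},\quad f^m_{i,k}=e^{i-k}_{-k,m},\quad f^m_{\overline i,\overline k}=e^{i-k}_{m,-k},\quad f^p_{m,m}=\sum_{s\in G}\chi(p,s)e^s_{m,m},$$ the other $f^x_{\alpha,\beta}$ spanning the last block. For a subgroup $L$ of $G$ let $\pi_L:B\to B_L=\bigoplus_{l\in L}M_\Omega(\mathbb C)$ be the projection which keeps the blocks indexed by $L$ and kills all others, and let $$I^L=\{b\in B:(\pi_L\otimes\mathrm{id})\Delta(b)=(\pi_L\otimes\mathrm{id})((1\otimes b)\Delta(1))\}$$ be the corresponding quotient type coideal. Let $I^\Omega$ be defined in the same way with $\pi_\Omega=\mathrm{id}_B$. Let $\overline{Subgrp(G)}=Subgrp(G)\sqcup\{\Omega\}$ be the lattice of subgroups of $G$ (with $L\wedge K=L\cap K$, $L\vee K=L+K$), completed by a new greatest element $\Omega$. Then the invariant coideals of $B$ form a sublattice $Invl(B)$ (under the operations $\wedge$, $\vee$ above), and $x\mapsto I^x$ is an anti-isomorphism of the lattice $\overline{Subgrp(G)}$ onto $Invl(B)$. In particular, for all subgroups $L,K$ of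 $G$, $$I^{L+K}=I^L\cap I^K\qquad\text{and}\qquad I^{L\cap K}=I^L\vee I^K .$$ -/

import Mathlib

open scoped TensorProduct ComplexConjugate

noncomputable section

set_option linter.unusedSectionVars false
set_option linter.unusedSimpArgs false
set_option linter.unusedTactic false
set_option linter.unreachableTactic false

namespace WeakHopf

/-! In this section `B` is a `*`-algebra with a comultiplication and an antipode `S`; the
definitions are used for weak Hopf `C^*`-algebras. All algebras are finite dimensional, so that the
unital `C^*`-subalgebras of `B` are exactly its unital `*`-subalgebras. -/

variable {B C : Type*} [Ring B] [Algebra ℂ B] [Coalgebra ℂ B] [Ring C] [Algebra ℂ C]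

/-- The right adjoint action `b ◁ x = S(x_(1)) b x_(2)`, as a linear function of `x`. -/
def adjointAction (S : B →ₗ[ℂ] B) (b : B) : B →ₗ[ℂ] B :=
  LinearMap.mul' ℂ B ∘ₗ TensorProduct.map (LinearMap.mulRight ℂ b ∘ₗ S) LinearMap.id ∘ₗ
    Coalgebra.comul

/-- A (right) coideal of `B`: a unital `*`-subalgebra `I` with `Δ(I) ⊆ I ⊗ B`. -/
def IsCoideal [StarRing B] [StarModule ℂ B] (I : StarSubalgebra ℂ B) : Prop :=
  ∀ b ∈ I, Coalgebra.comul (R := ℂ) b ∈ LinearMap.range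
    (TensorProduct.map (Subalgebra.toSubmodule I.toSubalgebra).subtype
      (LinearMap.id : B →ₗ[ℂ] B))

/-- An invariant coideal of `B`: a coideal `I` with `I ◁ B = I`. -/
def IsInvariantCoideal [StarRing B] [StarModule ℂ B] (S : B →ₗ[ℂ] B)
    (I : StarSubalgebra ℂ B) : Prop :=
  IsCoideal I ∧
    Submodule.span ℂ {y : B | ∃ b ∈ I, ∃ x : B, y = adjointAction S b x} =
      Subalgebra.toSubmodule I.toSubalgebra

/-- The fixed points of `B` under the left coaction `(π ⊗ id)Δ` attached to an epimorphism
`π : B → C`, that is `{b | (π ⊗ id)Δ(b) = (π ⊗ id)((1 ⊗ b)Δ(1))}`. -/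
def fixedPoints (π : B →ₐ[ℂ] C) : Submodule ℂ B where
  carrier := {b : B | TensorProduct.map π.toLinearMap LinearMap.id (Coalgebra.comul (R := ℂ) b) =
    TensorProduct.map π.toLinearMap LinearMap.id
      (((1 : B) ⊗ₜ[ℂ] b) * Coalgebra.comul (R := ℂ) (1 : B))}
  add_mem' {a b} ha hb := by
    simp only [Set.mem_setOf_eq] at ha hb ⊢
    rw [map_add, map_add, ha, hb, TensorProduct.tmul_add, add_mul, map_add]
  zero_mem' := by simp
  smul_mem' r b hb := by
    simp only [Set.mem_setOf_eq] at hb ⊢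
    rw [map_smul, map_smul, hb, TensorProduct.tmul_smul, smul_mul_assoc, map_smul]

end WeakHopf

namespace TambaraYamagami

/-- The data defining a Tambara-Yamagami category over a finite abelian group `G`: a
nondegenerate symmetric bicharacter `χ` with values in the unit circle, and a real number
`τ = ± |G|^{-1/2}`. -/
structure Datum (G : Type*) [AddCommGroup G] [Fintype G] where
  χ : G → G → Circle
  map_add_left : ∀ a b c : G, χ (a + b) c = χ a c * χ b c
  symm : ∀ a b : G, χ a b = χ b a
  nondegenerate : ∀ a : G, (∀ b : G, χ a b = 1) → a = 0
  τ : ℝ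
  τ_eq : τ = (√(Fintype.card G : ℝ))⁻¹ ∨ τ = -(√(Fintype.card G : ℝ))⁻¹

/-- Labels of the canonical basis vectors of `⨁ H^x`, where `x` runs over the simple objects
`G ⊔ {m}`. The label `inl (g, some h)` stands for `v^g_h`, `inl (g, none)` for `v^g_m`,
`inr (inl h)` for `v^m_h`, and `inr (inr h)` for `v^m_{h̄}` (so `none : Option G` is `m`, and the
two copies of `G` in `Ω_m = G ⊔ Ḡ` are the two summands of `G ⊕ G`). -/
abbrev VIdx (G : Type*) : Type _ := (G × Option G) ⊕ (G ⊕ G)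

/-- Labels of the canonical basis `f^x_{α,β} = v^x_α ⊗ conj(v^x_β)` of `⨁ H^x ⊗ conj(H^x)`:
`inl (g, α, β)` stands for `f^g_{α,β}` and `inr (α, β)` for `f^m_{α,β}`. -/
abbrev BIdx (G : Type*) : Type _ := (G × Option G × Option G) ⊕ ((G ⊕ G) × (G ⊕ G))

/-- The label of `v^x_α`, given the label of `f^x_{α,β}`. -/
def BIdx.left {G : Type*} : BIdx G → VIdx G
  | .inl (g, x, _) => .inl (g, x)
  | .inr (x, _) => .inr x

/-- The label of `v^x_β`, given the label of `f^x_{α,β}`. -/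
def BIdx.right {G : Type*} : BIdx G → VIdx G
  | .inl (g, _, y) => .inl (g, y)
  | .inr (_, y) => .inr y

variable {G : Type*} [AddCommGroup G] [Fintype G] [DecidableEq G]

/-- `D.circ v w z` is the coefficient of the basis vector `z` in `v ∘ w`. -/
def Datum.circ (D : Datum G) : VIdx G → VIdx G → VIdx G → ℂ
  | .inl (g, x), .inl (h, y), z =>
      if y = x.map (fun k => h + k) ∧ z = .inl (g + h, y) then 1 else 0
  | .inr (.inl k), .inl (g, x), z => if x = none ∧ z = .inr (.inl k) then (D.χ g k : ℂ) else 0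
  | .inr (.inr k), .inl (g, x), z =>
      if x = some (g + k) ∧ z = .inr (.inr (g + k)) then 1 else 0
  | .inl (g, x), .inr (.inr k), z => if x = none ∧ z = .inr (.inr k) then (D.χ g k : ℂ) else 0
  | .inl (g, x), .inr (.inl k), z => if x = some k ∧ z = .inr (.inl (k - g)) then 1 else 0
  | .inr (.inl h), .inr (.inr k), z => if z = .inl (k - h, some k) then 1 else 0
  | .inr (.inr h), .inr (.inl k), .inl (g, none) =>
      if h = k then (D.τ : ℂ) * ((D.χ g h)⁻¹ : Circle) else 0
  | .inr (.inr _), .inr (.inl _), _ => 0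
  | .inr (.inl _), .inr (.inl _), _ => 0
  | .inr (.inr _), .inr (.inr _), _ => 0

/-- The underlying vector space `B = ⨁ H^x ⊗ conj(H^x)` of the weak Hopf algebra `𝔊_TY`, in
coordinates with respect to the basis `f^x_{α,β}`. -/
def Datum.B (_D : Datum G) : Type _ := BIdx G → ℂ

namespace Datum

variable (D : Datum G)

instance : AddCommGroup D.B := inferInstanceAs (AddCommGroup (BIdx G → ℂ))
instance : Module ℂ D.B := inferInstanceAs (Module ℂ (BIdx G → ℂ))

/-- The canonical basis `f^x_{α,β}` of `B`. -/
def f : Module.Basis (BIdx G) ℂ D.B := Pi.basisFun ℂ (BIdx G)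

/-- The product of `B`: `f^x_{α,β} f^y_{γ,δ} = (v^x_α ∘ v^y_γ) ⊗ conj(v^x_β ∘ v^y_δ)`, the two
factors being decomposed along the simple objects and paired object by object. -/
instance : Mul D.B where
  mul b c := fun k => ∑ i, ∑ j, b i * c j *
    (D.circ (BIdx.left i) (BIdx.left j) (BIdx.left k) *
      conj (D.circ (BIdx.right i) (BIdx.right j) (BIdx.right k)))

/-- The unit of `B`, that is `∑_{α,β} f^0_{α,β}`. -/
instance : One D.B where
  one := ∑ x : Option G, ∑ y : Option G, D.f (.inl (0, x, y))

/-- The adjoints of the basis elements. -/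
def starBasis : BIdx G → D.B
  | .inl (g, x, y) => D.f (.inl (-g, x.map (fun h => h - g), y.map (fun h => h - g)))
  | .inr (.inl g, .inl h) => D.f (.inr (.inr g, .inr h))
  | .inr (.inl g, .inr h) => (D.τ : ℂ) • D.f (.inr (.inr g, .inl h))
  | .inr (.inr g, .inl h) => (D.τ : ℂ)⁻¹ • D.f (.inr (.inl g, .inr h))
  | .inr (.inr g, .inr h) => D.f (.inr (.inl g, .inl h))

/-- The involution of `B`. -/
instance : Star D.B where
  star b := ∑ i, conj (D.f.repr b i) • D.starBasis i

/-- The direct sum of matrix algebras `⨁_g M_{Ω}(ℂ) ⊕ M_{G ⊔ Ḡ}(ℂ)`, where `Ω = G ⊔ {m}`. It is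
isomorphic to the `*`-algebra `B` through the map `toBlocks` below, so that `B` is a
`C^*`-algebra. -/
abbrev Blocks (G : Type*) : Type _ :=
  (G → Matrix (Option G) (Option G) ℂ) × Matrix (G ⊕ G) (G ⊕ G) ℂ

/-- The expression of the `f^x_{α,β}` through the matrix units `e^s_{α,β}` (`s ∈ G`) and `e^m_{α,β}`
of `B`. For `l, a, c ∈ G` the matrix units of the blocks indexed by `G` are
`e^l_{a,c} = f^{a-c}_{l-c,-c}`, `e^l_{a,m} = f^m_{l-a,-a}`, `e^l_{m,c}` is `f^m` at the two barred
indices `l-c` and `-c`, and `f^p_{m,m} = ∑_l χ(p,l) e^l_{m,m}`. With them the comultiplication reads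
`Δ(e^l_{α,β}) = ∑_{l₁+l₂=l} e^{l₁}_{α-l₂,β-l₂} ⊗ e^{l₂}_{α,β}` up to terms in the block `e^m`
(`m - g = m`). -/
def blockBasis : BIdx G → Blocks G
  | .inl (p, some i, some k) =>
      (Pi.single (i - k) (Matrix.single (some (p - k)) (some (-k)) 1), 0)
  | .inl (p, none, none) => (fun s => Matrix.single none none (D.χ p s : ℂ), 0)
  | .inl (p, some i, none) => (0, Matrix.single (.inl (i - p)) (.inl i) 1)
  | .inl (p, none, some k) => (0, Matrix.single (.inr (k - p)) (.inr k) 1)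
  | .inr (.inl h, .inl k) => (Pi.single (h - k) (Matrix.single (some (-k)) none 1), 0)
  | .inr (.inr h, .inr k) => (Pi.single (h - k) (Matrix.single none (some (-k)) 1), 0)
  | .inr (.inl h, .inr k) =>
      (0, Matrix.single (.inl h) (.inr k) ((D.τ : ℂ) * ((D.χ h k)⁻¹ : Circle)))
  | .inr (.inr h, .inl k) => (0, Matrix.single (.inr k) (.inl h) (D.χ h k : ℂ))

/-- The isomorphism of `B` with the direct sum of its matrix blocks. -/
def toBlocks : D.B →ₗ[ℂ] Blocks G := D.f.constr ℂ D.blockBasis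

theorem f_apply (i j : BIdx G) : D.f i j = if j = i then 1 else 0 := by
  change (Pi.basisFun ℂ (BIdx G)) i j = _
  rw [Pi.basisFun_apply, Pi.single_apply]

theorem mul_apply (b c : D.B) (k : BIdx G) : (b * c) k = ∑ i, ∑ j, b i * c j *
    (D.circ (BIdx.left i) (BIdx.left j) (BIdx.left k) *
      conj (D.circ (BIdx.right i) (BIdx.right j) (BIdx.right k))) := rfl

theorem f_mul_f_apply (i j k : BIdx G) : (D.f i * D.f j) k =
    D.circ (BIdx.left i) (BIdx.left j) (BIdx.left k) *
      conj (D.circ (BIdx.right i) (BIdx.right j) (BIdx.right k)) := by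
  simp [mul_apply, f_apply]

@[ext] theorem ext_apply {b c : D.B} (h : ∀ k, b k = c k) : b = c := funext h

theorem add_apply (b c : D.B) (k : BIdx G) : (b + c) k = b k + c k := rfl
theorem zero_apply (k : BIdx G) : (0 : D.B) k = 0 := rfl
theorem smul_apply (a : ℂ) (b : D.B) (k : BIdx G) : (a • b) k = a * b k := rfl
theorem sum_apply {ι : Type*} (s : Finset ι) (b : ι → D.B) (k : BIdx G) :
    (∑ i ∈ s, b i) k = ∑ i ∈ s, b i k := Finset.sum_apply (M := fun _ => ℂ) k s b

theorem toBlocks_f (i : BIdx G) : D.toBlocks (D.f i) = D.blockBasis i := by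
  simp [toBlocks]

theorem χ_conj (a b : G) : conj (D.χ a b : ℂ) = ((D.χ a b)⁻¹ : Circle) :=
  (Circle.coe_inv_eq_conj _).symm

theorem f_grp_mul_f_grp (g h : G) (x y x' y' : Option G) :
    D.f (.inl (g, x, y)) * D.f (.inl (h, x', y')) =
      if x' = x.map (fun k => h + k) ∧ y' = y.map (fun k => h + k) then
        D.f (.inl (g + h, x', y')) else 0 := by
  ext k
  rw [f_mul_f_apply]
  rcases k with ⟨p, a, b⟩ | ⟨a, b⟩ <;> simp only [circ, BIdx.left, BIdx.right] <;>
    split_ifs <;> simp_all [f_apply, zero_apply]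

theorem f_dual_mul_f_grp (g : G) (x y : Option G) (a b : G ⊕ G) :
    D.f (.inr (a, b)) * D.f (.inl (g, x, y)) = match a, b with
      | .inl h, .inl k => if x = none ∧ y = none then
          ((D.χ g h : ℂ) * (conj (D.χ g k : ℂ))) • D.f (.inr (.inl h, .inl k)) else 0
      | .inl h, .inr k => if x = none ∧ y = some (g + k) then
          (D.χ g h : ℂ) • D.f (.inr (.inl h, .inr (g + k))) else 0
      | .inr h, .inl k => if x = some (g + h) ∧ y = none then
          (conj (D.χ g k : ℂ)) • D.f (.inr (.inr (g + h), .inl k)) else 0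
      | .inr h, .inr k => if x = some (g + h) ∧ y = some (g + k) then
          D.f (.inr (.inr (g + h), .inr (g + k))) else 0 := by
  ext k
  rw [f_mul_f_apply]
  rcases a with a | a <;> rcases b with b | b <;>
  rcases k with ⟨p, c, d⟩ | ⟨c, d⟩ <;> simp only [circ, BIdx.left, BIdx.right] <;>
    split_ifs <;> simp_all [f_apply, zero_apply, smul_apply]

theorem f_grp_mul_f_dual (g : G) (x y : Option G) (a b : G ⊕ G) :
    D.f (.inl (g, x, y)) * D.f (.inr (a, b)) = match a, b with
      | .inr h, .inr k => if x = none ∧ y = none then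
          ((D.χ g h : ℂ) * (conj (D.χ g k : ℂ))) • D.f (.inr (.inr h, .inr k)) else 0
      | .inr h, .inl k => if x = none ∧ y = some k then
          (D.χ g h : ℂ) • D.f (.inr (.inr h, .inl (k - g))) else 0
      | .inl h, .inr k => if x = some h ∧ y = none then
          (conj (D.χ g k : ℂ)) • D.f (.inr (.inl (h - g), .inr k)) else 0
      | .inl h, .inl k => if x = some h ∧ y = some k then
          D.f (.inr (.inl (h - g), .inl (k - g))) else 0 := by
  ext k
  rw [f_mul_f_apply]
  rcases a with a | a <;> rcases b with b | b <;>
  rcases k with ⟨p, c, d⟩ | ⟨c, d⟩ <;> simp only [circ, BIdx.left, BIdx.right] <;>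
    split_ifs <;> simp_all [f_apply, zero_apply, smul_apply]

theorem f_dual_mul_f_dual (a b c d : G ⊕ G) :
    D.f (.inr (a, b)) * D.f (.inr (c, d)) = match a, b, c, d with
      | .inl h, .inl h', .inr k, .inr k' =>
          if k - h = k' - h' then D.f (.inl (k - h, some k, some k')) else 0
      | .inr h, .inr h', .inl k, .inl k' => if h = k ∧ h' = k' then
          ∑ g : G, ((D.τ : ℂ) ^ 2 * ((D.χ g h)⁻¹ : Circle) * (D.χ g h' : ℂ)) •
            D.f (.inl (g, none, none)) else 0
      | .inl h, .inr h', .inr k, .inl k' => if h' = k' then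
          ((D.τ : ℂ) * (D.χ (k - h) h' : ℂ)) • D.f (.inl (k - h, some k, none)) else 0
      | .inr h, .inl h', .inl k, .inr k' => if h = k then
          ((D.τ : ℂ) * ((D.χ (k' - h') h)⁻¹ : Circle)) • D.f (.inl (k' - h', none, some k'))
          else 0
      | _, _, _, _ => 0 := by
  ext k
  rw [f_mul_f_apply]
  rcases a with a | a <;> rcases b with b | b <;> rcases c with c | c <;> rcases d with d | d <;>
    rcases k with ⟨p, _ | u, _ | v⟩ | ⟨u, v⟩ <;>
    simp only [circ, BIdx.left, BIdx.right] <;>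
    (try split_ifs) <;> simp_all [f_apply, zero_apply, smul_apply, sum_apply, χ_conj,
      pow_two, mul_assoc, mul_left_comm]

theorem χ_add_right (a b c : G) : D.χ a (b + c) = D.χ a b * D.χ a c := by
  rw [D.symm, D.map_add_left, D.symm b, D.symm c]

theorem χ_zero_left (a : G) : D.χ 0 a = 1 := by
  have := D.map_add_left 0 0 a
  simpa using this

theorem χ_zero_right (a : G) : D.χ a 0 = 1 := by rw [D.symm, χ_zero_left]

theorem χ_neg_left (a b : G) : D.χ (-a) b = (D.χ a b)⁻¹ := by
  rw [eq_inv_iff_mul_eq_one, ← D.map_add_left, neg_add_cancel, χ_zero_left]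

theorem χ_neg_right (a b : G) : D.χ a (-b) = (D.χ a b)⁻¹ := by
  rw [D.symm, χ_neg_left, D.symm]

theorem χ_sub_left (a b c : G) : D.χ (a - b) c = D.χ a c * (D.χ b c)⁻¹ := by
  rw [sub_eq_add_neg, D.map_add_left, χ_neg_left]

theorem χ_sub_right (a b c : G) : D.χ a (b - c) = D.χ a b * (D.χ a c)⁻¹ := by
  rw [sub_eq_add_neg, χ_add_right, χ_neg_right]

theorem τ_sq : D.τ ^ 2 * (Fintype.card G : ℝ) = 1 := by
  have h : (0 : ℝ) < Fintype.card G := by exact_mod_cast Fintype.card_pos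
  rcases D.τ_eq with e | e <;> rw [e] <;> simp [inv_pow, Real.sq_sqrt h.le, h.ne']

theorem τ_ne_zero : (D.τ : ℂ) ≠ 0 := by
  intro h
  have := D.τ_sq
  simp [Complex.ofReal_eq_zero.mp h] at this

/-- Orthogonality of characters. -/
theorem sum_χ (s : G) : ∑ g : G, (D.χ g s : ℂ) = if s = 0 then (Fintype.card G : ℂ) else 0 := by
  split_ifs with h
  · simp [h, χ_zero_right]
  · obtain ⟨b, hb⟩ : ∃ b, D.χ s b ≠ 1 := by
      by_contra! H
      exact h (D.nondegenerate s H)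
    have e : (D.χ b s : ℂ) * ∑ g : G, (D.χ g s : ℂ) = ∑ g : G, (D.χ g s : ℂ) := by
      rw [Finset.mul_sum]
      refine Fintype.sum_equiv (Equiv.addLeft b) _ _ fun g => ?_
      simp [D.map_add_left]
    have hb' : (D.χ b s : ℂ) ≠ 1 := by
      rw [D.symm]
      exact fun H => hb (Circle.ext (by simpa using H))
    by_contra H
    exact hb' (mul_right_cancel₀ H (e.trans (one_mul _).symm))

theorem single_mul_single_ite {ι : Type*} [Fintype ι] [DecidableEq ι] (i j k l : ι) (a b : ℂ) :
    Matrix.single i j a * Matrix.single k l b =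
      if j = k then Matrix.single i l (a * b) else 0 := by
  split_ifs with h
  · subst h; simp
  · simp [h]

theorem pi_single_mul_pi_single {A : Type*} [Semiring A] (s t : G) (a b : A) :
    (Pi.single s a * Pi.single t b : G → A) = if s = t then Pi.single s (a * b) else 0 := by
  split_ifs with h
  · subst h; ext x; by_cases hx : x = s <;> simp [hx]
  · ext x; by_cases hx : x = s
    · subst hx; simp [h]
    · simp [hx]

theorem fun_mul_pi_single {A : Type*} [Semiring A] (t : G) (u : G → A) (b : A) :
    (u * Pi.single t b : G → A) = Pi.single t (u t * b) := by
  ext x; by_cases hx : x = t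
  · subst hx; simp
  · simp [hx]

theorem pi_single_mul_fun {A : Type*} [Semiring A] (t : G) (u : G → A) (b : A) :
    (Pi.single t b * u : G → A) = Pi.single t (b * u t) := by
  ext x; by_cases hx : x = t
  · subst hx; simp
  · simp [hx]

theorem mk_zero_single_congr {i i' j j' : G ⊕ G} {a a' : ℂ} (hi : i = i') (hj : j = j')
    (ha : a = a') : ((0, Matrix.single i j a) : Blocks G) = (0, Matrix.single i' j' a') := by
  rw [hi, hj, ha]

theorem mk_single_zero_congr {s s' : G} {i i' j j' : Option G} {a a' : ℂ} (hs : s = s')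
    (hi : i = i') (hj : j = j') (ha : a = a') :
    ((Pi.single s (Matrix.single i j a), 0) : Blocks G) =
      (Pi.single s' (Matrix.single i' j' a'), 0) := by
  rw [hs, hi, hj, ha]

theorem sum_χ_three (a b s : G) :
    ∑ g : G, (D.τ : ℂ) ^ 2 * ((D.χ g a)⁻¹ : Circle) * (D.χ g b : ℂ) * (D.χ g s : ℂ) =
      if s = a - b then 1 else 0 := by
  have h : ∀ g : G, (D.τ : ℂ) ^ 2 * ((D.χ g a)⁻¹ : Circle) * (D.χ g b : ℂ) * (D.χ g s : ℂ) =
      (D.τ : ℂ) ^ 2 * (D.χ g (s - (a - b)) : ℂ) := by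
    intro g
    simp [χ_sub_right]
    ring
  have hτ : (D.τ : ℂ) ^ 2 * (Fintype.card G : ℂ) = 1 := by exact_mod_cast D.τ_sq
  simp_rw [h]
  rw [← Finset.mul_sum, sum_χ]
  simp only [sub_eq_zero]
  split_ifs
  · exact hτ
  · simp

theorem toBlocks_sum (a b : G) :
    D.toBlocks (∑ g : G, ((D.τ : ℂ) ^ 2 * ((D.χ g a)⁻¹ : Circle) * (D.χ g b : ℂ)) •
      D.f (.inl (g, none, none))) = (Pi.single (a - b) (Matrix.single none none 1), 0) := by
  rw [map_sum]
  simp only [map_smul, toBlocks_f, blockBasis, Prod.smul_mk, smul_zero]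
  refine Prod.ext ?_ (by simp [Prod.snd_sum])
  rw [Prod.fst_sum]
  funext s
  rw [Finset.sum_apply]
  simp only [Pi.smul_apply, Matrix.smul_single, smul_eq_mul]
  have h := D.sum_χ_three a b s
  have e := map_sum (Matrix.singleLinearMap ℂ (none : Option G) (none : Option G))
    (fun g : G => (D.τ : ℂ) ^ 2 * ((D.χ g a)⁻¹ : Circle) * (D.χ g b : ℂ) * (D.χ g s : ℂ))
    Finset.univ
  rw [h] at e
  refine e.symm.trans ?_
  by_cases hs : s = a - b
  · subst hs; simp
  · simp [hs]

theorem toBlocks_f_mul_f (i j : BIdx G) :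
    D.toBlocks (D.f i * D.f j) = D.toBlocks (D.f i) * D.toBlocks (D.f j) := by
  rcases i with ⟨g, x, y⟩ | ⟨a, b⟩ <;> rcases j with ⟨h, x', y'⟩ | ⟨c, d⟩
  · rw [f_grp_mul_f_grp]
    simp only [toBlocks_f]
    rcases x with _ | x <;> rcases y with _ | y <;> rcases x' with _ | x' <;>
      rcases y' with _ | y' <;>
      simp only [blockBasis, Prod.mk_mul_mk, Option.map_none, Option.map_some, reduceCtorEq,
        and_true, and_false, true_and, false_and, if_true, if_false, toBlocks_f, map_smul,
        apply_ite (D.toBlocks), map_zero, mul_zero, zero_mul, pi_single_mul_pi_single,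
        single_mul_single_ite, mul_one, one_mul, Sum.inl.injEq, Sum.inr.injEq, Option.some.injEq,
        Prod.mk_zero_zero, Pi.single_zero, ite_self, Prod.smul_mk, ← Pi.single_smul,
        Matrix.smul_single, smul_zero, smul_eq_mul]
    all_goals try simp only [fun_mul_pi_single, pi_single_mul_fun, single_mul_single_ite,
      reduceCtorEq, if_false, if_true, Pi.single_zero, Prod.mk_zero_zero]
    · ext s u v <;> simp [D.map_add_left]
    all_goals (try split_ifs) <;> first
      | (exfalso; grind)
      | (simp [Prod.mk_zero_zero]; done)
      | (rw [Pi.single_zero]; rfl)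
      | ((first | apply mk_zero_single_congr | apply mk_single_zero_congr) <;> first
          | grind
          | (simp_all; abel; done)
          | (rcases ‹_ ∧ _› with ⟨rfl, rfl⟩; congr 1; abel; done)
          | (simp_all [χ_sub_left, χ_sub_right, D.map_add_left, χ_add_right, χ_conj]; done)
          | (simp_all [χ_sub_left, χ_sub_right, D.map_add_left, χ_add_right, χ_conj]
             (try field_simp) <;> (rw [D.symm g h] <;> ring_nf)))
  · rw [f_grp_mul_f_dual]
    simp only [toBlocks_f]
    rcases x with _ | x <;> rcases y with _ | y <;> rcases c with c | c <;>
      rcases d with d | d <;>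
      simp only [blockBasis, Prod.mk_mul_mk, Option.map_none, Option.map_some, reduceCtorEq,
        and_true, and_false, true_and, false_and, if_true, if_false, toBlocks_f, map_smul,
        apply_ite (D.toBlocks), map_zero, mul_zero, zero_mul, pi_single_mul_pi_single,
        single_mul_single_ite, mul_one, one_mul, Sum.inl.injEq, Sum.inr.injEq, Option.some.injEq,
        Prod.mk_zero_zero, Pi.single_zero, ite_self, Prod.smul_mk, ← Pi.single_smul,
        Matrix.smul_single, smul_zero, smul_eq_mul]
    all_goals try simp only [fun_mul_pi_single, pi_single_mul_fun, single_mul_single_ite,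
      reduceCtorEq, if_false, if_true, Pi.single_zero, Prod.mk_zero_zero]
    all_goals (try split_ifs) <;> first
      | (exfalso; grind)
      | (simp [Prod.mk_zero_zero]; done)
      | (rw [Pi.single_zero]; rfl)
      | ((first | apply mk_zero_single_congr | apply mk_single_zero_congr) <;> first
          | grind
          | (simp_all; abel; done)
          | (rcases ‹_ ∧ _› with ⟨rfl, rfl⟩; congr 1; abel; done)
          | (simp_all [χ_sub_left, χ_sub_right, D.map_add_left, χ_add_right, χ_conj]; done)
          | (simp_all [χ_sub_left, χ_sub_right, D.map_add_left, χ_add_right, χ_conj]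
             (try field_simp) <;> (rw [D.symm g c] <;> ring_nf)))
  · rw [f_dual_mul_f_grp]
    simp only [toBlocks_f]
    rcases x' with _ | x' <;> rcases y' with _ | y' <;> rcases a with a | a <;>
      rcases b with b | b <;>
      simp only [blockBasis, Prod.mk_mul_mk, Option.map_none, Option.map_some, reduceCtorEq,
        and_true, and_false, true_and, false_and, if_true, if_false, toBlocks_f, map_smul,
        apply_ite (D.toBlocks), map_zero, mul_zero, zero_mul, pi_single_mul_pi_single,
        single_mul_single_ite, mul_one, one_mul, Sum.inl.injEq, Sum.inr.injEq, Option.some.injEq,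
        Prod.mk_zero_zero, Pi.single_zero, ite_self, Prod.smul_mk, ← Pi.single_smul,
        Matrix.smul_single, smul_zero, smul_eq_mul]
    all_goals try simp only [fun_mul_pi_single, pi_single_mul_fun, single_mul_single_ite,
      reduceCtorEq, if_false, if_true, Pi.single_zero, Prod.mk_zero_zero]
    all_goals (try split_ifs) <;> first
      | (exfalso; grind)
      | (simp [Prod.mk_zero_zero]; done)
      | (rw [Pi.single_zero]; rfl)
      | ((first | apply mk_zero_single_congr | apply mk_single_zero_congr) <;> first
          | grind
          | (simp_all; abel; done)
          | (rcases ‹_ ∧ _› with ⟨rfl, rfl⟩; congr 1; abel; done)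
          | (simp_all [χ_sub_left, χ_sub_right, D.map_add_left, χ_add_right, χ_conj]; done)
          | (simp_all [χ_sub_left, χ_sub_right, D.map_add_left, χ_add_right, χ_conj]
             (try field_simp) <;> (rw [D.symm h a] <;> ring_nf)))
  · rw [f_dual_mul_f_dual]
    simp only [toBlocks_f]
    rcases a with a | a <;> rcases b with b | b <;> rcases c with c | c <;>
      rcases d with d | d <;>
      simp only [blockBasis, Prod.mk_mul_mk, Option.map_none, Option.map_some, reduceCtorEq,
        and_true, and_false, true_and, false_and, if_true, if_false, toBlocks_f, map_smul,
        apply_ite (D.toBlocks), map_zero, mul_zero, zero_mul, pi_single_mul_pi_single,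
        single_mul_single_ite, mul_one, one_mul, Sum.inl.injEq, Sum.inr.injEq, Option.some.injEq,
        Prod.mk_zero_zero, Pi.single_zero, ite_self, Prod.smul_mk, ← Pi.single_smul,
        Matrix.smul_single, smul_zero, smul_eq_mul]
    all_goals try simp only [fun_mul_pi_single, pi_single_mul_fun, single_mul_single_ite,
      reduceCtorEq, if_false, if_true, Pi.single_zero, Prod.mk_zero_zero]
    all_goals (try split_ifs) <;> first
      | (exfalso; grind)
      | (simp [Prod.mk_zero_zero]; done)
      | (rw [Pi.single_zero]; rfl)
      | (rcases ‹_ ∧ _› with ⟨rfl, rfl⟩; exact D.toBlocks_sum _ _)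
      | ((first | apply mk_zero_single_congr | apply mk_single_zero_congr) <;> first
          | grind
          | (simp_all; abel; done)
          | (rcases ‹_ ∧ _› with ⟨rfl, rfl⟩; congr 1; abel; done)
          | (simp_all [χ_sub_left, χ_sub_right, D.map_add_left, χ_add_right, χ_conj]; done)
          | (simp_all [χ_sub_left, χ_sub_right, D.map_add_left, χ_add_right, χ_conj]
             (try field_simp) <;> (rw [D.symm b c, D.symm d c] <;> ring_nf)))

theorem B_add_mul (a b c : D.B) : (a + b) * c = a * c + b * c := by
  ext k
  simp only [mul_apply, add_apply, add_mul, Finset.sum_add_distrib]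

theorem B_mul_add (a b c : D.B) : a * (b + c) = a * b + a * c := by
  ext k
  simp only [mul_apply, add_apply, mul_add, add_mul, Finset.sum_add_distrib]

theorem B_smul_mul (r : ℂ) (a b : D.B) : (r • a) * b = r • (a * b) := by
  ext k
  simp only [mul_apply, smul_apply, Finset.mul_sum, mul_assoc]

theorem B_mul_smul (r : ℂ) (a b : D.B) : a * (r • b) = r • (a * b) := by
  ext k
  simp only [mul_apply, smul_apply, Finset.mul_sum]
  refine Finset.sum_congr rfl fun i _ => Finset.sum_congr rfl fun j _ => ?_
  ring

/-- The product of `B` as a bilinear map. -/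
def mulLin : D.B →ₗ[ℂ] D.B →ₗ[ℂ] D.B :=
  LinearMap.mk₂ ℂ (fun a b => a * b) D.B_add_mul D.B_smul_mul D.B_mul_add D.B_mul_smul

theorem toBlocks_mul (a b : D.B) : D.toBlocks (a * b) = D.toBlocks a * D.toBlocks b := by
  have h : D.mulLin.compr₂ D.toBlocks =
      ((LinearMap.mul ℂ (Blocks G)).comp D.toBlocks).compl₂ D.toBlocks :=
    D.f.ext fun i => D.f.ext fun j => D.toBlocks_f_mul_f i j
  exact congrArg (fun F => F a b) h

/-- The coordinates of an element of `B` as functions of its matrix blocks. -/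
def fromBlocksFun (M : Blocks G) : BIdx G → ℂ
  | .inl (p, some i, some k) => M.1 (i - k) (some (p - k)) (some (-k))
  | .inl (p, none, none) =>
      (Fintype.card G : ℂ)⁻¹ * ∑ s : G, ((D.χ p s)⁻¹ : Circle) * M.1 s none none
  | .inl (p, some i, none) => M.2 (.inl (i - p)) (.inl i)
  | .inl (p, none, some k) => M.2 (.inr (k - p)) (.inr k)
  | .inr (.inl h, .inl k) => M.1 (h - k) (some (-k)) none
  | .inr (.inr h, .inr k) => M.1 (h - k) none (some (-k))
  | .inr (.inl h, .inr k) => (D.τ : ℂ)⁻¹ * (D.χ h k : ℂ) * M.2 (.inl h) (.inr k)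
  | .inr (.inr h, .inl k) => ((D.χ h k)⁻¹ : Circle) * M.2 (.inr k) (.inl h)

/-- The linear map underlying `fromBlocksFun`. -/
def fromBlocks : Blocks G →ₗ[ℂ] D.B where
  toFun M := D.fromBlocksFun M
  map_add' M N := by
    ext k
    change D.fromBlocksFun (M + N) k = D.fromBlocksFun M k + D.fromBlocksFun N k
    rcases k with ⟨p, _ | i, _ | k⟩ | ⟨h | h, k | k⟩ <;>
      simp [fromBlocksFun, mul_add, Finset.sum_add_distrib]
  map_smul' r M := by
    ext k
    change D.fromBlocksFun (r • M) k = r * D.fromBlocksFun M k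
    rcases k with ⟨p, _ | i, _ | k⟩ | ⟨h | h, k | k⟩ <;>
      simp [fromBlocksFun, Finset.mul_sum, mul_left_comm]

theorem fromBlocks_apply (M : Blocks G) (k : BIdx G) :
    D.fromBlocks M k = D.fromBlocksFun M k := rfl

theorem pi_single_single_apply (s t : G) (i j u v : Option G) (a : ℂ) :
    (Pi.single s (Matrix.single i j a) : G → Matrix (Option G) (Option G) ℂ) t u v =
      if t = s ∧ i = u ∧ j = v then a else 0 := by
  by_cases h : t = s
  · subst h; simp [Matrix.single_apply]
  · simp [h]

theorem fromBlocks_blockBasis (i : BIdx G) : D.fromBlocks (D.blockBasis i) = D.f i := by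
  ext j
  rw [fromBlocks_apply, f_apply]
  rcases i with ⟨p, _ | i, _ | k⟩ | ⟨h | h, k | k⟩ <;>
    rcases j with ⟨p', _ | i', _ | k'⟩ | ⟨h' | h', k' | k'⟩ <;>
    simp [fromBlocksFun, blockBasis, pi_single_single_apply, Matrix.single_apply]
  · have h : ∀ s : G, (D.χ p' s : ℂ)⁻¹ * (D.χ p s : ℂ) = (D.χ s (p - p') : ℂ) := by
      intro s
      rw [χ_sub_right, D.symm s p, D.symm s p']
      simp [mul_comm]
    simp_rw [h, sum_χ, sub_eq_zero, eq_comm (a := p)]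
    split_ifs <;> simp
  · grind
  · grind
  · grind
  · grind
  · have h1 := D.τ_ne_zero
    have h2 : (D.χ h k : ℂ) ≠ 0 := Circle.coe_ne_zero _
    split_ifs with c1 c2 c2
    · obtain ⟨rfl, rfl⟩ := c1
      field_simp
    · grind
    · grind
    · rfl
  · split_ifs <;> first | grind | simp_all
  · grind

theorem fromBlocks_toBlocks (b : D.B) : D.fromBlocks (D.toBlocks b) = b := by
  have h : D.fromBlocks ∘ₗ D.toBlocks = LinearMap.id := D.f.ext fun i => by
    simp [toBlocks_f, fromBlocks_blockBasis]
  exact congrArg (fun F => F b) h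

theorem toBlocks_injective : Function.Injective D.toBlocks :=
  Function.LeftInverse.injective D.fromBlocks_toBlocks

theorem toBlocks_one : D.toBlocks 1 = 1 := by
  change D.toBlocks (∑ x : Option G, ∑ y : Option G, D.f (.inl (0, x, y))) = 1
  have e : ∀ s i k : G, s = i - k ↔ i = s + k := fun s i k => by
    rw [eq_sub_iff_add_eq, eq_comm]
  simp only [Fintype.sum_option, map_add, map_sum, toBlocks_f, blockBasis]
  refine Prod.ext (funext fun s => Matrix.ext fun u v => ?_) (Matrix.ext fun u v => ?_)
  · rcases u with _ | u <;> rcases v with _ | v <;>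
    simp [Prod.fst_sum, Finset.sum_apply, Matrix.sum_apply, pi_single_single_apply, e, ite_and,
      neg_eq_iff_eq_neg, χ_zero_left, Matrix.one_apply]
    rw [Finset.sum_comm]
    simp [neg_inj]
  · rcases u with u | u <;> rcases v with v | v <;>
    simp [Prod.snd_sum, Finset.sum_apply, Matrix.sum_apply, Matrix.single_apply, ite_and,
      Matrix.one_apply]

theorem toBlocks_starBasis (i : BIdx G) : D.toBlocks (D.starBasis i) = star (D.blockBasis i) := by
  have e : ∀ p k : G, -p - (k - p) = -k := fun p k => by abel
  rcases i with ⟨p, _ | i, _ | k⟩ | ⟨h | h, k | k⟩ <;>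
    refine Prod.ext (funext fun s => Matrix.ext fun u v => ?_) (Matrix.ext fun u v => ?_) <;>
    simp [starBasis, toBlocks_f, blockBasis, Matrix.star_apply, Matrix.single_apply,
      pi_single_single_apply, χ_neg_left, χ_conj, apply_ite (starRingEnd ℂ), D.τ_ne_zero, e]
  all_goals grind

theorem toBlocks_star (b : D.B) : D.toBlocks (star b) = star (D.toBlocks b) := by
  conv_rhs => rw [← D.f.sum_repr b, map_sum, star_sum]
  change D.toBlocks (∑ i, conj (D.f.repr b i) • D.starBasis i) = _
  rw [map_sum]
  refine Finset.sum_congr rfl fun i _ => ?_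
  rw [map_smul, map_smul, star_smul, toBlocks_f, toBlocks_starBasis]
  rfl

/-- `B` is an associative unital ring. -/
instance : Ring D.B :=
  { (inferInstance : AddCommGroup D.B), (inferInstance : Mul D.B), (inferInstance : One D.B) with
    left_distrib := D.B_mul_add
    right_distrib := D.B_add_mul
    zero_mul := fun a => by simpa using D.B_smul_mul 0 0 a
    mul_zero := fun a => by simpa using D.B_mul_smul 0 a 0
    mul_assoc := fun a b c => D.toBlocks_injective (by simp only [toBlocks_mul, mul_assoc])
    one_mul := fun a => D.toBlocks_injective (by rw [toBlocks_mul, toBlocks_one, one_mul])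
    mul_one := fun a => D.toBlocks_injective (by rw [toBlocks_mul, toBlocks_one, mul_one]) }

instance : Algebra ℂ D.B := Algebra.ofModule D.B_smul_mul D.B_mul_smul

/-- `B` is a `*`-algebra. -/
instance : StarRing D.B where
  star_involutive a := D.toBlocks_injective (by rw [toBlocks_star, toBlocks_star, star_star])
  star_mul a b := D.toBlocks_injective (by
    rw [toBlocks_star, toBlocks_mul, toBlocks_mul, star_mul, toBlocks_star, toBlocks_star])
  star_add a b := D.toBlocks_injective (by
    simp only [toBlocks_star, map_add, star_add])

instance : StarModule ℂ D.B where
  star_smul r a := D.toBlocks_injective (by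
    simp only [toBlocks_star, map_smul, star_smul])

/-- The comultiplication of `B`: `Δ(f^x_{α,β}) = ∑_γ f^x_{α,γ} ⊗ f^x_{γ,β}`. -/
def comulBasis : BIdx G → D.B ⊗[ℂ] D.B
  | .inl (g, x, y) => ∑ z : Option G, D.f (.inl (g, x, z)) ⊗ₜ[ℂ] D.f (.inl (g, z, y))
  | .inr (x, y) => ∑ z : G ⊕ G, D.f (.inr (x, z)) ⊗ₜ[ℂ] D.f (.inr (z, y))

/-- The counit of `B`: `ε(f^x_{α,β}) = δ_{α,β}`. -/
def counitBasis : BIdx G → ℂ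
  | .inl (_, x, y) => if x = y then 1 else 0
  | .inr (x, y) => if x = y then 1 else 0

instance : CoalgebraStruct ℂ D.B where
  comul := D.f.constr ℂ D.comulBasis
  counit := D.f.constr ℂ counitBasis

theorem comul_f (i : BIdx G) : Coalgebra.comul (R := ℂ) (D.f i) = D.comulBasis i :=
  D.f.constr_basis ℂ D.comulBasis i

theorem counit_f (i : BIdx G) : Coalgebra.counit (R := ℂ) (D.f i) = counitBasis i :=
  D.f.constr_basis ℂ counitBasis i

instance : Coalgebra ℂ D.B where
  coassoc := D.f.ext fun i => by
    rcases i with ⟨g, x, y⟩ | ⟨x, y⟩ <;>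
      simp only [LinearMap.comp_apply, comul_f, comulBasis, map_sum, LinearMap.rTensor_tmul,
        LinearMap.lTensor_tmul, TensorProduct.sum_tmul, TensorProduct.tmul_sum,
        LinearEquiv.coe_coe, TensorProduct.assoc_tmul] <;>
      exact Finset.sum_comm
  rTensor_counit_comp_comul := D.f.ext fun i => by
    rcases i with ⟨g, x, y⟩ | ⟨x, y⟩ <;>
      simp [comul_f, counit_f, comulBasis, counitBasis, TensorProduct.ite_tmul,
        -Fintype.sum_sum_type, -Fintype.sum_option]
  lTensor_counit_comp_comul := D.f.ext fun i => by
    rcases i with ⟨g, x, y⟩ | ⟨x, y⟩ <;>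
      simp [comul_f, counit_f, comulBasis, counitBasis, TensorProduct.tmul_ite,
        -Fintype.sum_sum_type, -Fintype.sum_option]

/-- The values of the antipode on the basis elements. -/
def antipodeBasis : BIdx G → D.B
  | .inl (g, x, y) => D.f (.inl (-g, y.map (fun h => h - g), x.map (fun h => h - g)))
  | .inr (.inl g, .inl h) => D.f (.inr (.inr h, .inr g))
  | .inr (.inl g, .inr h) => (D.τ : ℂ)⁻¹ • D.f (.inr (.inl h, .inr g))
  | .inr (.inr g, .inl h) => (D.τ : ℂ) • D.f (.inr (.inr h, .inl g))
  | .inr (.inr g, .inr h) => D.f (.inr (.inl h, .inl g))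

/-- The antipode of `B`. -/
def antipode : D.B →ₗ[ℂ] D.B := D.f.constr ℂ D.antipodeBasis

/-- The projection `π_L : B → B_L`, for a subgroup `L` of `G`. Here `B_L = ⨁_{l ∈ L} B(H^l)` is
the algebra of the quantum subgroupoid `𝔊^L`, and `π_L` keeps the matrix units `e^l_{α,β}` with
`l ∈ L` and sends all the other matrix units of `B` to zero. -/
def subgroupoidProj (L : AddSubgroup G) : D.B →⋆ₐ[ℂ] (L → Matrix (Option G) (Option G) ℂ) where
  toFun b := fun l => (D.toBlocks b).1 l
  map_one' := by rw [toBlocks_one]; rfl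
  map_mul' a b := by rw [toBlocks_mul]; rfl
  map_zero' := by rw [map_zero]; rfl
  map_add' a b := by rw [map_add]; rfl
  commutes' r := by
    rw [Algebra.algebraMap_eq_smul_one, Algebra.algebraMap_eq_smul_one, map_smul, toBlocks_one]
    rfl
  map_star' b := by rw [toBlocks_star]; rfl

/-- The quotient type coideal `I^x = I(𝔊^x \ 𝔊_TY)`, for `x` in the lattice of subgroups of `G`
completed by a new greatest element `Ω`, written `⊤`. The quantum subgroupoid of index `Ω` is
`𝔊_TY` itself, with the identity map; the one whose index is a subgroup `L` is `(𝔊^L, π_L)`. -/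
def quotientTypeCoideal : WithTop (AddSubgroup G) → Submodule ℂ D.B
  | ⊤ => WeakHopf.fixedPoints (AlgHom.id ℂ D.B)
  | (L : AddSubgroup G) => WeakHopf.fixedPoints (D.subgroupoidProj L).toAlgHom

end Datum
end TambaraYamagami
end

open scoped TensorProduct ComplexConjugate

set_option linter.unusedSectionVars false

noncomputable section

/-! Since `Δ(φ ⊗ conj(v_y)) = ∑_z (φ ⊗ conj(v_z)) ⊗ f_{z,y}`, slicing the second leg of `Δ` shows
that a coideal is a sum of spaces `V_x ⊗ conj(H^x)`: only the first tensor factors carry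
information.

Every value of the adjoint action commutes with the idempotents `∑_y f^0_{z,y}`, so it involves only
basis vectors `v` whose two ends agree. These are the `v^0_x` and the `v^g_m`; the vectors of `H^m`
have distinct ends. Hence an invariant coideal amounts to an algebra `A = V_0` of functions on `Ω =
G ⊔ {m}` together with the set of those `g ≠ 0` for which `v^g_m` occurs.

The action of the `f^h` translates the functions of `A` (`translate_mem`). The action of the `f^m`
is a Fourier transform: it carries `v^g_m` to the character `χ(g,·)` on `G` and back (`chiVec_mem`,
`f_none_mem`). So `A` alone determines the coideal: for `g ≠ 0`, `v^g_m` occurs exactly when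
`χ(g,·)`, extended by zero at `m`, lies in `A`. Now `A` is determined by the pairs of points it does
not separate. If it separates some pair, translation shows that `m` is separated from all of `G` and
that non-separation on `G` is congruence modulo a subgroup `L`; then `A` consists of the
`L`-invariant functions, and the `g` that occur are those annihilating `L`. If it separates none,
`A` is the constants and no `v^g_m` with `g ≠ 0` occurs.

The fixed point equations of `I^L` and `I^Ω`, read in matrix units, give these same vectors
(`invVec`), and conversely all of these spaces are invariant coideals. Order reversal and the
formula for intersections are then read off from the vectors. The formula for joins uses `(L ∩ K)^⊥
= L^⊥ + K^⊥` for the vectors at `m`, and separation of points for the functions on `G`. -/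

/-- The Stone-Weierstrass theorem for a finite space: a subalgebra of `X → 𝕜` contains every
function which is constant on the classes of points that it does not separate. -/
theorem Subalgebra.mem_of_forall_not_separated {X 𝕜 : Type*} [Fintype X] [Field 𝕜] [CharZero 𝕜]
    (A : Subalgebra 𝕜 (X → 𝕜)) {ψ : X → 𝕜}
    (h : ∀ x y, (∀ φ ∈ A, φ x = φ y) → ψ x = ψ y) : ψ ∈ A := by
  classical
  -- The value at `y` is prescribed only when some element of `A` separates `x` from `y`; otherwise
  -- the constant `1` serves.
  have sep : ∀ x y, ∃ e ∈ A, e x = 1 ∧ ((¬ ∀ φ ∈ A, φ x = φ y) → e y = 0) := by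
    intro x y
    by_cases hxy : ∀ φ ∈ A, φ x = φ y
    · exact ⟨1, A.one_mem, rfl, fun h' => absurd hxy h'⟩
    · have hxy' := hxy
      push Not at hxy
      obtain ⟨φ, hφ, hne⟩ := hxy
      refine ⟨(φ x - φ y)⁻¹ • (φ - algebraMap 𝕜 (X → 𝕜) (φ y)),
        A.smul_mem (A.sub_mem hφ (A.algebraMap_mem _)) _, ?_, fun _ => ?_⟩
      · simp [sub_ne_zero.2 hne]
      · simp
  choose e heA hex hey using sep
  -- `E x` is the indicator function of the class of points not separated from `x`.
  let E : X → X → 𝕜 := fun x => ∏ y, e x y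
  have hEA : ∀ x, E x ∈ A := fun x => A.prod_mem fun y _ => heA x y
  have hE : ∀ x z, E x z = if ∀ φ ∈ A, φ x = φ z then 1 else 0 := by
    intro x z
    split_ifs with hxz
    · rw [← hxz _ (hEA x)]
      simp [E, hex]
    · simp only [E, Finset.prod_apply]
      exact Finset.prod_eq_zero (Finset.mem_univ z) (hey x z hxz)
  -- `N x` is the size of the class of `x`. In `∑ ψ(x) E x` each class is counted once for each of
  -- its points, and division by `N x` corrects this; characteristic zero makes it legitimate.
  let N : X → 𝕜 := fun x => ∑ z, E z x
  have hN : ∀ x, N x ≠ 0 := by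
    intro x
    simp only [N, hE, Finset.sum_boole, ne_eq, Nat.cast_eq_zero, Finset.card_eq_zero]
    exact Finset.ne_empty_of_mem (a := x) (by simp)
  have hψ : ψ = ∑ x, (ψ x / N x) • E x := by
    funext z
    have : ∀ x, ((ψ x / N x) • E x) z = (ψ z / N z) * E x z := by
      intro x
      by_cases hxz : ∀ φ ∈ A, φ x = φ z
      · have hNN : N x = N z := by
          refine Finset.sum_congr rfl fun w _ => ?_
          exact hxz _ (hEA w)
        simp [h x z hxz, hNN]
      · simp [hE, if_neg hxz]
    rw [Finset.sum_apply, Finset.sum_congr rfl fun x _ => this x, ← Finset.mul_sum]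
    exact (div_mul_cancel₀ _ (hN z)).symm
  rw [hψ]
  exact A.sum_mem fun x _ => A.smul_mem (hEA x) _

namespace TambaraYamagami

namespace Datum

variable {G : Type*} [AddCommGroup G] [Fintype G] [DecidableEq G] (D : Datum G)

/-! ### Columns `φ ⊗ conj(v^g_y)` and the graded subspaces they span -/

/-- The element `∑_x φ(x) f^g_{x,y}` of `B`, that is `φ ⊗ conj(v^g_y)` for a vector `φ` of `H^g`. -/
def col (g : G) (y : Option G) : (Option G → ℂ) →ₗ[ℂ] D.B where
  toFun φ := ∑ x, φ x • D.f (.inl (g, x, y))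
  map_add' φ ψ := by simp only [Pi.add_apply, add_smul, Finset.sum_add_distrib]
  map_smul' r φ := by simp only [Pi.smul_apply, smul_eq_mul, mul_smul, Finset.smul_sum,
    RingHom.id_apply]

theorem col_apply (g : G) (y : Option G) (φ : Option G → ℂ) :
    D.col g y φ = ∑ x, φ x • D.f (.inl (g, x, y)) := rfl

theorem col_coord_inl (g h : G) (x y z : Option G) (φ : Option G → ℂ) :
    D.col g y φ (.inl (h, x, z)) = if h = g ∧ z = y then φ x else 0 := by
  rw [col_apply, sum_apply]
  simp only [smul_apply, f_apply, Sum.inl.injEq, Prod.mk.injEq, mul_ite, mul_one, mul_zero]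
  by_cases h1 : h = g ∧ z = y
  · simp [h1]
  · rw [if_neg h1]
    refine Finset.sum_eq_zero fun w _ => if_neg ?_
    tauto

theorem col_coord_inr (g : G) (y : Option G) (φ : Option G → ℂ) (p : (G ⊕ G) × (G ⊕ G)) :
    D.col g y φ (.inr p) = 0 := by
  rw [col_apply, sum_apply]
  simp [smul_apply, f_apply]

theorem col_single (g : G) (x y : Option G) : D.col g y (Pi.single x 1) = D.f (.inl (g, x, y)) := by
  ext k
  rcases k with ⟨h, w, z⟩ | p
  · simp only [col_coord_inl, f_apply, Pi.single_apply, Sum.inl.injEq, Prod.mk.injEq]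
    split_ifs <;> first | rfl | (exfalso; tauto)
  · simp [col_coord_inr, f_apply]

/-- The product `v^g_k ∘ v^h_x` survives only for `x = h + k`, so first factors multiply pointwise
after translating the left one by `h`, and the same rule ties `z` to `y`. For `g = h = 0` this is
the algebra of functions on `G ⊔ {m}`. -/
theorem col_mul_col (g h : G) (y z : Option G) (φ ψ : Option G → ℂ) :
    D.col g y φ * D.col h z ψ = if z = y.map (fun k => h + k) then
      D.col (g + h) z (fun x => φ (x.map (fun k => k - h)) * ψ x) else 0 := by
  have e : ∀ x x' : Option G, x' = x.map (fun k => h + k) ↔ x = x'.map (fun k => k - h) := by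
    rintro (_ | x) (_ | x') <;> simp [eq_sub_iff_add_eq, add_comm, eq_comm]
  rw [col_apply, col_apply, Finset.sum_mul_sum]
  simp only [smul_mul_smul_comm, f_grp_mul_f_grp]
  split_ifs with hz
  · simp only [hz, and_true, smul_ite, smul_zero]
    rw [Finset.sum_comm, col_apply]
    refine Finset.sum_congr rfl fun x' _ => ?_
    simp only [e]
    rw [Finset.sum_ite_eq' Finset.univ]
    simp
  · simp [hz]

theorem star_f (i : BIdx G) : star (D.f i) = D.starBasis i := by
  change ∑ j, conj (D.f.repr (D.f i) j) • D.starBasis j = _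
  simp [Finsupp.single_apply, apply_ite (starRingEnd ℂ)]

theorem star_col (g : G) (y : Option G) (φ : Option G → ℂ) :
    star (D.col g y φ) = D.col (-g) (y.map (fun h => h - g))
      (fun x => conj (φ (x.map (fun h => h + g)))) := by
  rw [col_apply, star_sum, col_apply]
  let e : Option G ≃ Option G := Equiv.optionCongr (Equiv.subRight g)
  refine Fintype.sum_equiv e _ _ fun x => ?_
  rw [star_smul, star_f]
  rcases x with _ | x <;> simp [starBasis, e]

theorem one_eq_sum_col : (1 : D.B) = ∑ y, D.col 0 y 1 := by
  change ∑ x : Option G, ∑ y : Option G, D.f (.inl (0, x, y)) = _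
  rw [Finset.sum_comm]
  simp [col_apply]

/-- The vector `φ` is untouched and only the second index of the first leg varies. This is why a
coideal is a condition on the spaces of vectors, the same for all `y`. -/
theorem comul_col (g : G) (y : Option G) (φ : Option G → ℂ) :
    Coalgebra.comul (R := ℂ) (D.col g y φ) =
      ∑ z, D.col g z φ ⊗ₜ[ℂ] D.f (.inl (g, z, y)) := by
  simp only [col_apply, map_sum, map_smul, comul_f, comulBasis, TensorProduct.sum_tmul,
    Finset.smul_sum, TensorProduct.smul_tmul']
  rw [Finset.sum_comm]

theorem eq_sum_col {b : D.B} (h : ∀ p, b (.inr p) = 0) :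
    b = ∑ g, ∑ y, D.col g y (fun x => b (.inl (g, x, y))) := by
  ext k
  rcases k with ⟨g, x, y⟩ | p
  · simp [sum_apply, col_coord_inl, ite_and, -Fintype.sum_option]
  · simp [sum_apply, col_coord_inr, h, -Fintype.sum_option]

/-- The subspace `⨁_g V_g ⊗ conj(H^g)` of `B`, for subspaces `V_g` of `H^g`. -/
def graded (V : G → Submodule ℂ (Option G → ℂ)) : Submodule ℂ D.B where
  carrier := {b | (∀ p, b (.inr p) = 0) ∧ ∀ g y, (fun x => b (.inl (g, x, y))) ∈ V g}
  add_mem' {a b} ha hb := ⟨fun p => by rw [add_apply, ha.1, hb.1, add_zero],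
    fun g y => (V g).add_mem (ha.2 g y) (hb.2 g y)⟩
  zero_mem' := ⟨fun _ => rfl, fun g _ => (V g).zero_mem⟩
  smul_mem' r b hb := ⟨fun p => by rw [smul_apply, hb.1, mul_zero],
    fun g y => (V g).smul_mem r (hb.2 g y)⟩

theorem mem_graded {V : G → Submodule ℂ (Option G → ℂ)} {b : D.B} : b ∈ D.graded V ↔
    (∀ p, b (.inr p) = 0) ∧ ∀ g y, (fun x => b (.inl (g, x, y))) ∈ V g := Iff.rfl

theorem col_mem_graded {V : G → Submodule ℂ (Option G → ℂ)} {g : G} {y : Option G}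
    {φ : Option G → ℂ} : D.col g y φ ∈ D.graded V ↔ φ ∈ V g := by
  rw [mem_graded]
  constructor
  · intro h
    simpa [col_coord_inl] using h.2 g y
  · refine fun h => ⟨fun p => D.col_coord_inr g y φ p, fun h' z => ?_⟩
    simp only [col_coord_inl]
    by_cases e : h' = g ∧ z = y
    · obtain ⟨rfl, rfl⟩ := e
      simpa using h
    · simp only [e, if_false]
      exact (V h').zero_mem

theorem graded_induction {V : G → Submodule ℂ (Option G → ℂ)} {p : D.B → Prop}
    (hcol : ∀ g y, ∀ φ ∈ V g, p (D.col g y φ)) (hadd : ∀ a b, p a → p b → p (a + b))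
    (hzero : p 0) {b : D.B} (hb : b ∈ D.graded V) : p b := by
  rw [D.eq_sum_col hb.1]
  refine Finset.sum_induction _ p hadd hzero fun g _ => ?_
  exact Finset.sum_induction _ p hadd hzero fun y _ => hcol g y _ (hb.2 g y)

/-- The coideal `⨁_g V_g ⊗ conj(H^g)`, when the sum of the `V_g` contains the unit and is closed
under the product and the involution. -/
def gradedStarSubalgebra (V : G → Submodule ℂ (Option G → ℂ)) (one_mem : 1 ∈ V 0)
    (mul_mem : ∀ g h, ∀ φ ∈ V g, ∀ ψ ∈ V h,
      (fun x : Option G => φ (x.map (fun k => k - h)) * ψ x) ∈ V (g + h))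
    (star_mem : ∀ g, ∀ φ ∈ V g,
      (fun x : Option G => conj (φ (x.map (fun h => h + g)))) ∈ V (-g)) :
    StarSubalgebra ℂ D.B where
  toSubalgebra := (D.graded V).toSubalgebra
    (by
      rw [one_eq_sum_col]
      exact Submodule.sum_mem _ fun y _ => D.col_mem_graded.2 one_mem)
    (by
      intro a b ha hb
      refine D.graded_induction (p := fun a => a * b ∈ D.graded V) (fun g y φ hφ => ?_)
        (fun a a' h h' => by rw [add_mul]; exact Submodule.add_mem _ h h')
        (by rw [zero_mul]; exact Submodule.zero_mem _) ha
      refine D.graded_induction (p := fun b => D.col g y φ * b ∈ D.graded V) (fun h z ψ hψ => ?_)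
        (fun a a' h h' => by rw [mul_add]; exact Submodule.add_mem _ h h')
        (by rw [mul_zero]; exact Submodule.zero_mem _) hb
      rw [col_mul_col]
      split_ifs
      · exact D.col_mem_graded.2 (mul_mem g h φ hφ ψ hψ)
      · exact Submodule.zero_mem _)
  star_mem' {a} ha := by
    refine D.graded_induction (p := fun a => star a ∈ D.graded V) (fun g y φ hφ => ?_)
        (fun a a' h h' => by rw [star_add]; exact Submodule.add_mem _ h h')
        (by rw [star_zero]; exact Submodule.zero_mem _) ha
    rw [star_col]
    exact D.col_mem_graded.2 (star_mem g φ hφ)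

theorem isCoideal_of_toSubmodule_eq_graded {V : G → Submodule ℂ (Option G → ℂ)}
    {J : StarSubalgebra ℂ D.B} (hJ : Subalgebra.toSubmodule J.toSubalgebra = D.graded V) :
    WeakHopf.IsCoideal J := by
  intro b hb
  replace hb : b ∈ D.graded V := hJ ▸ hb
  refine D.graded_induction (p := fun b => Coalgebra.comul (R := ℂ) b ∈ LinearMap.range
    (TensorProduct.map (Subalgebra.toSubmodule J.toSubalgebra).subtype
      (LinearMap.id : D.B →ₗ[ℂ] D.B))) (fun g y φ hφ => ?_)
        (fun a a' h h' => by rw [map_add]; exact Submodule.add_mem _ h h')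
        (by rw [map_zero]; exact Submodule.zero_mem _) hb
  rw [comul_col]
  refine Submodule.sum_mem _ fun z _ => ?_
  have hm : D.col g z φ ∈ Subalgebra.toSubmodule J.toSubalgebra := by
    rw [hJ]
    exact D.col_mem_graded.2 hφ
  exact ⟨(⟨_, hm⟩ : Subalgebra.toSubmodule J.toSubalgebra) ⊗ₜ D.f (.inl (g, z, y)), by simp⟩

/-! ### Fixed points -/

/-- The coordinate of an element of `C ⊗ B` at a basis element of `B`. -/
def slice {C : Type*} [AddCommGroup C] [Module ℂ C] (k : BIdx G) : C ⊗[ℂ] D.B →ₗ[ℂ] C :=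
  (TensorProduct.rid ℂ C).toLinearMap ∘ₗ TensorProduct.map LinearMap.id (D.f.coord k)

theorem coord_eq (b : D.B) (k : BIdx G) : D.f.coord k b = b k := rfl

theorem slice_tmul {C : Type*} [AddCommGroup C] [Module ℂ C] (k : BIdx G) (c : C) (b : D.B) :
    D.slice k (c ⊗ₜ[ℂ] b) = b k • c := by
  simp [slice, -Module.Basis.coord_apply, coord_eq]

theorem sum_slice_tmul {C : Type*} [AddCommGroup C] [Module ℂ C] (t : C ⊗[ℂ] D.B) :
    ∑ k, D.slice k t ⊗ₜ[ℂ] D.f k = t := by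
  induction t with
  | zero => simp
  | add s t hs ht => simp only [map_add, TensorProduct.add_tmul, Finset.sum_add_distrib, hs, ht]
  | tmul c b =>
    conv_rhs => rw [← D.f.sum_repr b, TensorProduct.tmul_sum]
    refine Finset.sum_congr rfl fun k _ => ?_
    rw [slice_tmul, TensorProduct.smul_tmul]
    rfl

theorem slice_ext {C : Type*} [AddCommGroup C] [Module ℂ C] {s t : C ⊗[ℂ] D.B}
    (h : ∀ k, D.slice k s = D.slice k t) : s = t := by
  rw [← D.sum_slice_tmul s, ← D.sum_slice_tmul t]
  simp only [h]

/-- The right end of a basis vector: `v^g_x` has right end `x`, `v^m_k` has `m`, and `v^m_{k̄}` has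
`k`. -/
def rightEnd : VIdx G → Option G
  | .inl (_, x) => x
  | .inr (.inl _) => none
  | .inr (.inr k) => some k

/-- The left end of a basis vector: `v^g_x` has left end `x - g`, `v^m_k` has `k`, and `v^m_{k̄}` has
`m`. -/
def leftEnd : VIdx G → Option G
  | .inl (g, x) => x.map (fun k => k - g)
  | .inr (.inl k) => some k
  | .inr (.inr _) => none

/-- The idempotent `∑_y f^0_{z,y}`. -/
def rowUnit (z : Option G) : D.B := ∑ y, D.f (.inl (0, z, y))

theorem f_mul_rowUnit (i : BIdx G) (z : Option G) :
    D.f i * D.rowUnit z = if z = rightEnd (BIdx.left i) then D.f i else 0 := by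
  rw [rowUnit, Finset.mul_sum]
  rcases i with ⟨g, x, y⟩ | ⟨a | a, b | b⟩
  · simp only [f_grp_mul_f_grp, zero_add, add_zero, Option.map_id', BIdx.left, rightEnd]
    by_cases h : z = x <;> simp [h, -Fintype.sum_option]
  all_goals
    simp only [f_dual_mul_f_grp, zero_add, χ_zero_left, BIdx.left, rightEnd]
    rcases z with _ | z <;> simp [ite_and]

theorem rowUnit_mul_f (i : BIdx G) (z : Option G) :
    D.rowUnit z * D.f i = if z = leftEnd (BIdx.left i) then D.f i else 0 := by
  rw [rowUnit, Finset.sum_mul]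
  rcases i with ⟨g, x, y⟩ | ⟨a | a, b | b⟩
  · have e : ∀ x x' : Option G, x' = x.map (fun k => g + k) ↔ x = x'.map (fun k => k - g) := by
      rintro (_ | x) (_ | x') <;> simp [eq_sub_iff_add_eq, add_comm, eq_comm]
    simp only [f_grp_mul_f_grp, zero_add, BIdx.left, leftEnd, e]
    by_cases h : z = x.map (fun k => k - g) <;> simp [h, -Fintype.sum_option]
  all_goals
    simp only [f_grp_mul_f_dual, χ_zero_left, BIdx.left, leftEnd]
    rcases z with _ | z <;> simp [ite_and]

/-- In this form the right side of the fixed point equation is explicit: multiplying `b` by `rowUnit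
z` keeps the coordinates with right end `z`. -/
theorem comul_one : Coalgebra.comul (R := ℂ) (1 : D.B) =
    ∑ z, D.col 0 z 1 ⊗ₜ[ℂ] D.rowUnit z := by
  rw [one_eq_sum_col, map_sum]
  simp only [comul_col, rowUnit, TensorProduct.tmul_sum]
  rw [Finset.sum_comm]

theorem mul_rowUnit_apply (b : D.B) (z : Option G) (k : BIdx G) :
    (b * D.rowUnit z) k = if z = rightEnd (BIdx.left k) then b k else 0 := by
  have hb : b = ∑ i, b i • D.f i := (D.f.sum_repr b).symm
  conv_lhs => rw [hb, Finset.sum_mul]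
  simp only [smul_mul_assoc, f_mul_rowUnit, sum_apply, smul_apply]
  rw [Finset.sum_eq_single k]
  · split_ifs <;> simp [f_apply, zero_apply]
  · intro i _ hi
    split_ifs <;> simp [f_apply, zero_apply, hi.symm]
  · simp

theorem rowUnit_mul_apply (b : D.B) (z : Option G) (k : BIdx G) :
    (D.rowUnit z * b) k = if z = leftEnd (BIdx.left k) then b k else 0 := by
  have hb : b = ∑ i, b i • D.f i := (D.f.sum_repr b).symm
  conv_lhs => rw [hb, Finset.mul_sum]
  simp only [mul_smul_comm, rowUnit_mul_f, sum_apply, smul_apply]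
  rw [Finset.sum_eq_single k]
  · split_ifs <;> simp [f_apply, zero_apply]
  · intro i _ hi
    split_ifs <;> simp [f_apply, zero_apply, hi.symm]
  · simp

theorem slice_comul_inl {C : Type*} [AddCommGroup C] [Module ℂ C] (π : D.B →ₗ[ℂ] C) (b : D.B)
    (g : G) (z y : Option G) :
    D.slice (.inl (g, z, y)) (TensorProduct.map π LinearMap.id (Coalgebra.comul (R := ℂ) b)) =
      ∑ x, b (.inl (g, x, y)) • π (D.f (.inl (g, x, z))) := by
  have hb : b = ∑ i, b i • D.f i := (D.f.sum_repr b).symm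
  conv_lhs => rw [hb]
  simp only [map_sum, map_smul, comul_f]
  rw [Fintype.sum_sum_type]
  simp only [comulBasis, map_sum, TensorProduct.map_tmul, slice_tmul, f_apply,
    LinearMap.id_apply, Fintype.sum_prod_type, Sum.inl.injEq, Prod.mk.injEq, reduceCtorEq,
    if_false, zero_smul, Finset.sum_const_zero, smul_zero, add_zero, ite_and]
  simp [-Fintype.sum_option]

theorem slice_comul_inr {C : Type*} [AddCommGroup C] [Module ℂ C] (π : D.B →ₗ[ℂ] C) (b : D.B)
    (z y : G ⊕ G) :
    D.slice (.inr (z, y)) (TensorProduct.map π LinearMap.id (Coalgebra.comul (R := ℂ) b)) =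
      ∑ x, b (.inr (x, y)) • π (D.f (.inr (x, z))) := by
  have hb : b = ∑ i, b i • D.f i := (D.f.sum_repr b).symm
  conv_lhs => rw [hb]
  simp only [map_sum, map_smul, comul_f]
  rw [Fintype.sum_sum_type]
  simp only [comulBasis, map_sum, TensorProduct.map_tmul, slice_tmul, f_apply,
    LinearMap.id_apply, Fintype.sum_prod_type, Sum.inr.injEq, Prod.mk.injEq, reduceCtorEq,
    if_false, zero_smul, Finset.sum_const_zero, smul_zero, zero_add, ite_and]
  simp [-Fintype.sum_option, -Fintype.sum_sum_type]

theorem slice_mul_comul_one {C : Type*} [Ring C] [Algebra ℂ C] (π : D.B →ₗ[ℂ] C)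
    (b : D.B) (k : BIdx G) :
    D.slice k (TensorProduct.map π LinearMap.id
      (((1 : D.B) ⊗ₜ[ℂ] b) * Coalgebra.comul (R := ℂ) (1 : D.B))) =
      b k • π (D.col 0 (rightEnd (BIdx.left k)) 1) := by
  rw [comul_one, Finset.mul_sum]
  simp only [Algebra.TensorProduct.tmul_mul_tmul, one_mul, map_sum, TensorProduct.map_tmul,
    slice_tmul, LinearMap.id_apply, mul_rowUnit_apply]
  simp [-Fintype.sum_option]

/-- Compare the coordinates of both sides at `f_{z,y}` in the second leg. The index `y` is a mere
parameter, so the equation is one on the columns of `b`. -/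
theorem mem_fixedPoints_iff {C : Type*} [Ring C] [Algebra ℂ C] (π : D.B →ₐ[ℂ] C) (b : D.B) :
    b ∈ WeakHopf.fixedPoints π ↔
      (∀ g z y, ∑ x, b (.inl (g, x, y)) • π (D.f (.inl (g, x, z))) =
        b (.inl (g, z, y)) • π (D.col 0 z 1)) ∧
      (∀ z y, ∑ x, b (.inr (x, y)) • π (D.f (.inr (x, z))) =
        b (.inr (z, y)) • π (D.col 0 (rightEnd (.inr z)) 1)) := by
  change TensorProduct.map π.toLinearMap LinearMap.id (Coalgebra.comul (R := ℂ) b) =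
    TensorProduct.map π.toLinearMap LinearMap.id
      (((1 : D.B) ⊗ₜ[ℂ] b) * Coalgebra.comul (R := ℂ) (1 : D.B)) ↔ _
  constructor
  · intro h
    refine ⟨fun g z y => ?_, fun z y => ?_⟩
    · have := congrArg (D.slice (.inl (g, z, y))) h
      rwa [slice_comul_inl, slice_mul_comul_one] at this
    · have := congrArg (D.slice (.inr (z, y))) h
      rwa [slice_comul_inr, slice_mul_comul_one] at this
  · rintro ⟨h1, h2⟩
    refine D.slice_ext ?_
    rintro (⟨g, z, y⟩ | ⟨z, y⟩)
    · rw [slice_comul_inl, slice_mul_comul_one]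
      exact h1 g z y
    · rw [slice_comul_inr, slice_mul_comul_one]
      exact h2 z y

/-! ### Fixed vectors of the quantum subgroupoids -/

/-- The vectors of `H^g` fixed by the quantum subgroupoid of index `x`. -/
def invVec : WithTop (AddSubgroup G) → G → Submodule ℂ (Option G → ℂ)
  | ⊤, g =>
    { carrier := {φ | (g ≠ 0 → φ = 0) ∧ ∀ x y, φ x = φ y}
      add_mem' := fun ha hb => ⟨fun h => by rw [ha.1 h, hb.1 h, add_zero],
        fun x y => by rw [Pi.add_apply, Pi.add_apply, ha.2 x y, hb.2 x y]⟩
      zero_mem' := ⟨fun _ => rfl, fun _ _ => rfl⟩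
      smul_mem' := fun r _ ha => ⟨fun h => by rw [ha.1 h, smul_zero],
        fun x y => by rw [Pi.smul_apply, Pi.smul_apply, ha.2 x y]⟩ }
  | (L : AddSubgroup G), g =>
    { carrier := {φ | (g ≠ 0 → ∀ i, φ (some i) = 0) ∧ (∀ i, ∀ l ∈ L, φ (some (i + l)) = φ (some i)) ∧
        ∀ l ∈ L, (D.χ g l : ℂ) * φ none = φ none}
      add_mem' := fun ha hb => ⟨fun h i => by rw [Pi.add_apply, ha.1 h, hb.1 h, add_zero],
        fun i l hl => by rw [Pi.add_apply, Pi.add_apply, ha.2.1 i l hl, hb.2.1 i l hl],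
        fun l hl => by rw [Pi.add_apply, mul_add, ha.2.2 l hl, hb.2.2 l hl]⟩
      zero_mem' := ⟨fun _ _ => rfl, fun _ _ _ => rfl, fun _ _ => by simp⟩
      smul_mem' := fun r _ ha => ⟨fun h i => by rw [Pi.smul_apply, ha.1 h, smul_zero],
        fun i l hl => by rw [Pi.smul_apply, Pi.smul_apply, ha.2.1 i l hl],
        fun l hl => by rw [Pi.smul_apply, mul_smul_comm, ha.2.2 l hl]⟩ }

theorem mem_invVec_top {g : G} {φ : Option G → ℂ} :
    φ ∈ D.invVec ⊤ g ↔ (g ≠ 0 → φ = 0) ∧ ∀ x y, φ x = φ y := Iff.rfl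

/-- The last condition lets `φ` be nonzero at `m` only if `χ(g,·)` is trivial on `L`. It reflects
`f^g_{m,m} = ∑_s χ(g,s) e^s_{m,m}`. -/
theorem mem_invVec_coe {L : AddSubgroup G} {g : G} {φ : Option G → ℂ} :
    φ ∈ D.invVec (L : WithTop (AddSubgroup G)) g ↔ (g ≠ 0 → ∀ i, φ (some i) = 0) ∧
      (∀ i, ∀ l ∈ L, φ (some (i + l)) = φ (some i)) ∧
        ∀ l ∈ L, (D.χ g l : ℂ) * φ none = φ none := Iff.rfl

/-- With `π = id` the equation equates a combination of the `f^x_{·,z}` with a multiple of `∑_w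
f^0_{w,z'}`, where `z'` is the right end of `v^x_z`. Linear independence kills every coordinate with
`x ≠ 0` and makes columns with `x = 0` constant. -/
theorem quotientTypeCoideal_top : D.quotientTypeCoideal ⊤ = D.graded (D.invVec ⊤) := by
  ext b
  change b ∈ WeakHopf.fixedPoints (AlgHom.id ℂ D.B) ↔ _
  rw [mem_fixedPoints_iff, mem_graded]
  simp only [AlgHom.id_apply, mem_invVec_top]
  constructor
  · rintro ⟨h1, h2⟩
    refine ⟨?_, fun g y => ⟨fun hg => funext fun x => ?_, fun x z => ?_⟩⟩
    · rintro ⟨a, c⟩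
      have := congrArg (fun d : D.B => d (.inr (a, a))) (h2 a c)
      simpa [sum_apply, smul_apply, f_apply, col_coord_inr, -Fintype.sum_sum_type] using this
    · have := congrArg (fun d : D.B => d (.inl (g, x, x))) (h1 g x y)
      simpa [-Fintype.sum_option, ← col_apply, smul_apply, col_coord_inl, hg] using this
    · by_cases hg : g = 0
      · subst hg
        have := congrArg (fun d : D.B => d (.inl (0, x, z))) (h1 0 z y)
        simpa [-Fintype.sum_option, ← col_apply, smul_apply, col_coord_inl] using this
      · have e : ∀ w, b (.inl (g, w, y)) = 0 := fun w => by
          have := congrArg (fun d : D.B => d (.inl (g, w, w))) (h1 g w y)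
          simpa [-Fintype.sum_option, ← col_apply, smul_apply, col_coord_inl, hg] using this
        rw [e, e]
  · rintro ⟨h1, h2⟩
    refine ⟨fun g z y => ?_, fun z y => by simp [h1]⟩
    rw [← col_apply]
    by_cases hg : g = 0
    · subst hg
      rw [← map_smul]
      congr 1
      funext x
      simpa using (h2 0 y).2 x z
    · rw [(h2 g y).1 hg, map_zero, show b (.inl (g, z, y)) = 0 from congrFun ((h2 g y).1 hg) z,
        zero_smul]

theorem subgroupoidProj_f (L : AddSubgroup G) (i : BIdx G) :
    (D.subgroupoidProj L).toAlgHom (D.f i) = fun l : L => (D.blockBasis i).1 l := by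
  rw [← toBlocks_f]; rfl

theorem subgroupoidProj_col_one (L : AddSubgroup G) (z : Option G) (l : L) :
    (D.subgroupoidProj L).toAlgHom (D.col 0 z 1) l =
      Matrix.single (z.map fun k => -k) (z.map fun k => -k) 1 := by
  rw [col_apply, map_sum, Finset.sum_apply]
  simp only [subgroupoidProj_f, Pi.one_apply, one_smul]
  rcases z with _ | k
  · simp [blockBasis, χ_zero_left]
  · ext u v
    have e : ∀ i : G, (l : G) = i - k ↔ i = l + k := fun i => by
      rw [eq_sub_iff_add_eq, eq_comm]
    simp [blockBasis, Matrix.sum_apply, pi_single_single_apply, Matrix.single_apply, e, ite_and]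

theorem quotientTypeCoideal_coe (L : AddSubgroup G) :
    D.quotientTypeCoideal L = D.graded (D.invVec L) := by
  ext b
  change b ∈ WeakHopf.fixedPoints (D.subgroupoidProj L).toAlgHom ↔ _
  rw [mem_fixedPoints_iff, mem_graded]
  have key : ∀ {s t : L → Matrix (Option G) (Option G) ℂ}, s = t ↔ ∀ l u v, s l u v = t l u v :=
    ⟨fun h => by simp [h], fun h => funext fun l => Matrix.ext fun u v => h l u v⟩
  simp only [key, subgroupoidProj_f]
  simp only [Pi.smul_apply, Finset.sum_apply, subgroupoidProj_col_one,
    Matrix.sum_apply, Matrix.smul_apply, mem_invVec_coe]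
  constructor
  · rintro ⟨h1, h2⟩
    -- In block `l` the equation at `z = i` reads `b(g, i+l, y) e_{g-i,-i} = b(g, i, y) e_{-i,-i}`.
    -- For `g ≠ 0` the two matrix units differ, and block `0` already gives the vanishing.
    have h0 : ∀ g y, g ≠ 0 → ∀ i, b (.inl (g, some i, y)) = 0 := fun g y hg i => by
      have := h1 g (some i) y 0 (some (g - i)) (some (-i))
      simpa [blockBasis, pi_single_single_apply, rightEnd, Matrix.single_apply, eq_comm,
          sub_eq_zero, hg] using this
    refine ⟨?_, fun g y => ⟨h0 g y, fun i l hl => ?_, fun l hl => ?_⟩⟩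
    -- For `x = m` the left side is off-diagonal (`e_{-k,m}` or `e_{m,-k}`) and the right side is
    -- diagonal; the entry in block `0` isolates one coordinate.
    · rintro ⟨k | k, y⟩
      · have := h2 (.inl k) y 0 (some (-k)) none
        simpa [blockBasis, pi_single_single_apply, rightEnd, Matrix.single_apply, eq_comm,
          sub_eq_zero] using this
      · have := h2 (.inr k) y 0 none (some (-k))
        simpa [blockBasis, pi_single_single_apply, rightEnd, Matrix.single_apply, eq_comm,
          sub_eq_zero] using this
    · have := h1 g (some i) y ⟨l, hl⟩ (some (g - i)) (some (-i))
      have e : ∀ j : G, l = j - i ↔ j = i + l := fun j => by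
        rw [eq_sub_iff_add_eq, eq_comm, add_comm]
      by_cases hg : g = 0
      · simpa [blockBasis, pi_single_single_apply, rightEnd, Matrix.single_apply,
          sub_eq_zero, hg, e] using this
      · rw [h0 g y hg, h0 g y hg]
    · have := h1 g none y ⟨l, hl⟩ none none
      simpa [blockBasis, mul_comm] using this
  · rintro ⟨h1, h2⟩
    refine ⟨?_, fun z y l u v => by simp [h1]⟩
    rintro g (_ | i) y ⟨l, hl⟩ u v
    · have := (h2 g y).2.2 l hl
      rcases u with _ | u <;> rcases v with _ | v <;>
        simp [blockBasis, mul_comm]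
      simpa [mul_comm] using this
    · have e : ∀ j : G, l = j - i ↔ j = i + l := fun j => by
        rw [eq_sub_iff_add_eq, eq_comm, add_comm]
      have h := (h2 g y).2.1 i l hl
      by_cases hg : g = 0
      · subst hg
        rcases u with _ | u <;> rcases v with _ | v <;>
        simp [blockBasis, Matrix.single_apply, pi_single_single_apply, e, ite_and, h]
      · have h0 := (h2 g y).1 hg
        simp [blockBasis, Matrix.single_apply, pi_single_single_apply, e, ite_and, h0]

/-! ### The adjoint action -/

theorem antipode_f (i : BIdx G) : D.antipode (D.f i) = D.antipodeBasis i :=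
  D.f.constr_basis ℂ D.antipodeBasis i

theorem adjointAction_f_inl (b : D.B) (h : G) (c d : Option G) :
    WeakHopf.adjointAction D.antipode b (D.f (.inl (h, c, d))) =
      ∑ e, D.antipodeBasis (.inl (h, c, e)) * b * D.f (.inl (h, e, d)) := by
  simp only [WeakHopf.adjointAction, LinearMap.comp_apply, comul_f, comulBasis, map_sum,
    TensorProduct.map_tmul, antipode_f, LinearMap.mulRight_apply, LinearMap.mul'_apply,
    LinearMap.id_apply]

theorem adjointAction_f_inr (b : D.B) (c d : G ⊕ G) :
    WeakHopf.adjointAction D.antipode b (D.f (.inr (c, d))) =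
      ∑ e, D.antipodeBasis (.inr (c, e)) * b * D.f (.inr (e, d)) := by
  simp only [WeakHopf.adjointAction, LinearMap.comp_apply, comul_f, comulBasis, map_sum,
    TensorProduct.map_tmul, antipode_f, LinearMap.mulRight_apply, LinearMap.mul'_apply,
    LinearMap.id_apply]

/-- Each term of the sum over the middle index multiplies `φ` by a delta function on both sides. The
term at `x` survives only if `x + g = x`, and what remains is `φ` translated by `h`. -/
theorem adjointAction_col_f_inl (g h : G) (y c d : Option G) (φ : Option G → ℂ) :
    WeakHopf.adjointAction D.antipode (D.col g y φ) (D.f (.inl (h, c, d))) =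
      if c = y.map (fun k => k + h - g) ∧ d = y.map (fun k => k + h) then
        D.col g d (fun x => if x.map (fun k => k + g) = x then φ (x.map (fun k => k - h)) else 0)
      else 0 := by
  have e1 : ∀ x, D.antipodeBasis (.inl (h, c, x)) = D.col (-h) (c.map fun k => k - h)
      (Pi.single (x.map fun k => k - h) 1) := fun x => (D.col_single _ _ _).symm
  have e2 : ∀ x, D.f (.inl (h, x, d)) = D.col h d (Pi.single x 1) := fun x =>
    (D.col_single _ _ _).symm
  have c1 : y = Option.map (fun k => g + k) (Option.map (fun k => k - h) c) ↔
      c = y.map (fun k => k + h - g) := by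
    rcases y with _ | y <;> rcases c with _ | c <;> simp <;> grind
  have c2 : d = y.map (fun k => h + k) ↔ d = y.map (fun k => k + h) := by simp only [add_comm]
  rw [adjointAction_f_inl]
  simp only [e1, e2, col_mul_col, c1]
  by_cases hc : c = y.map (fun k => k + h - g)
  swap
  · simp only [hc, if_false, zero_mul, Finset.sum_const_zero, false_and]
  by_cases hd : d = y.map (fun k => k + h)
  swap
  · simp only [hc, if_true, col_mul_col, c2, hd, if_false, and_false, Finset.sum_const_zero]
  have c3 := c2.2 hd
  simp only [← hc, if_true, col_mul_col, ← c3, ← hd, and_self]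
  rw [show -h + g + h = g by abel, ← map_sum]
  congr 1
  funext x
  rw [Finset.sum_apply]
  simp only [Pi.single_apply, mul_ite, mul_one, mul_zero]
  rw [Finset.sum_ite_eq]
  rcases x with _ | x
  · simp
  · simp

/-- In `∑_e S(f_{c,e}) b f_{e,d}` the left end of `S(f_{c,e})` and the right end of `f_{e,d}` are
both the right end of `v_e`. Multiplication by `rowUnit z` on either side therefore selects the same
terms. -/
theorem rowUnit_mul_adjointAction (z : Option G) (b x : D.B) :
    D.rowUnit z * WeakHopf.adjointAction D.antipode b x =
      WeakHopf.adjointAction D.antipode b x * D.rowUnit z := by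
  have hS : ∀ i, D.rowUnit z * D.antipodeBasis i =
      if z = rightEnd (BIdx.right i) then D.antipodeBasis i else 0 := by
    rintro (⟨g, x, _ | y⟩ | ⟨a | a, b | b⟩) <;>
      simp [antipodeBasis, rowUnit_mul_f, leftEnd, rightEnd, BIdx.left, BIdx.right] <;>
      split_ifs <;> simp_all
  suffices h : LinearMap.mulLeft ℂ (D.rowUnit z) ∘ₗ WeakHopf.adjointAction D.antipode b =
      LinearMap.mulRight ℂ (D.rowUnit z) ∘ₗ WeakHopf.adjointAction D.antipode b from
    congrArg (fun F => F x) h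
  refine D.f.ext fun i => ?_
  rcases i with ⟨h, c, d⟩ | ⟨c, d⟩
  · simp only [LinearMap.comp_apply, LinearMap.mulLeft_apply, LinearMap.mulRight_apply,
      adjointAction_f_inl, Finset.mul_sum, Finset.sum_mul]
    refine Finset.sum_congr rfl fun e _ => ?_
    rw [← mul_assoc, ← mul_assoc, hS, mul_assoc _ _ (D.rowUnit z), f_mul_rowUnit]
    by_cases hz : z = e <;> simp [hz, BIdx.left, BIdx.right, rightEnd]
  · simp only [LinearMap.comp_apply, LinearMap.mulLeft_apply, LinearMap.mulRight_apply,
      adjointAction_f_inr, Finset.mul_sum, Finset.sum_mul]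
    refine Finset.sum_congr rfl fun e _ => ?_
    rw [← mul_assoc, ← mul_assoc, hS, mul_assoc _ _ (D.rowUnit z), f_mul_rowUnit]
    by_cases hz : z = rightEnd (.inr e) <;> simp [hz, BIdx.left, BIdx.right]

/-- The value of the adjoint action at any element commutes with the row units, so that it is
supported on the basis vectors whose two ends agree. -/
theorem adjointAction_apply_eq_zero (b x : D.B) {k : BIdx G}
    (hk : leftEnd (BIdx.left k) ≠ rightEnd (BIdx.left k)) :
    WeakHopf.adjointAction D.antipode b x k = 0 := by
  have h := congrArg (fun c : D.B => c k)
    (D.rowUnit_mul_adjointAction (leftEnd (BIdx.left k)) b x)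
  simpa [rowUnit_mul_apply, mul_rowUnit_apply, hk] using h

theorem adjointAction_add_left (a b x : D.B) :
    WeakHopf.adjointAction D.antipode (a + b) x =
      WeakHopf.adjointAction D.antipode a x + WeakHopf.adjointAction D.antipode b x := by
  suffices h : WeakHopf.adjointAction D.antipode (a + b) =
      WeakHopf.adjointAction D.antipode a + WeakHopf.adjointAction D.antipode b from
    congrArg (fun F => F x) h
  refine D.f.ext fun i => ?_
  rcases i with ⟨h, c, d⟩ | ⟨c, d⟩
  · simp only [LinearMap.add_apply, adjointAction_f_inl, mul_add, add_mul,
      Finset.sum_add_distrib]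
  · simp only [LinearMap.add_apply, adjointAction_f_inr, mul_add, add_mul,
      Finset.sum_add_distrib]

theorem adjointAction_zero_left (x : D.B) :
    WeakHopf.adjointAction D.antipode 0 x = 0 := by
  have h := D.adjointAction_add_left 0 0 x
  simpa using h

/-! ### Action of the `f^m` and the Fourier transform -/

/-- The character `χ(g, ·)` of `G`, extended by zero to `G ⊔ {m}`. -/
def chiVec (g : G) : Option G → ℂ
  | none => 0
  | some k => D.χ g k

/-- The Fourier transform of the restriction to `G` of a function on `G ⊔ {m}`. -/
def fourier (φ : Option G → ℂ) (p : G) : ℂ := ∑ k, φ (some k) * ((D.χ p k)⁻¹ : Circle)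

theorem τ_sq_mul_card : (D.τ : ℂ) ^ 2 * (Fintype.card G : ℂ) = 1 := by exact_mod_cast D.τ_sq

theorem fourier_chiVec (g p : G) :
    D.fourier (D.chiVec g) p = if p = g then (Fintype.card G : ℂ) else 0 := by
  have h : ∀ k, (D.chiVec g (some k)) * ((D.χ p k)⁻¹ : Circle) = (D.χ k (g - p) : ℂ) := by
    intro k
    rw [χ_sub_right, D.symm k g, D.symm k p]
    simp [chiVec]
  rw [fourier]
  simp_rw [h, sum_χ, sub_eq_zero, eq_comm (a := g)]

/-- Substitute `k - l` for `k`. Consequently the transform of an `L`-invariant function is supported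
on the annihilator of `L`. -/
theorem fourier_mul_of_invariant {φ : Option G → ℂ} {l : G}
    (h : ∀ i, φ (some (i + l)) = φ (some i)) (p : G) :
    (D.χ p l : ℂ) * D.fourier φ p = D.fourier φ p := by
  conv_rhs => rw [fourier]
  rw [← Equiv.sum_comp (Equiv.subRight l), fourier, Finset.mul_sum]
  refine Finset.sum_congr rfl fun k _ => ?_
  have := h (k - l)
  rw [sub_add_cancel] at this
  rw [Equiv.subRight_apply, ← this, χ_sub_right]
  simp
  ring

theorem f_dual_mul_col (y : Option G) (φ : Option G → ℂ) (h : φ none = 0) (a b : G ⊕ G) :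
    D.f (.inr (a, b)) * D.col 0 y φ = match a with
      | .inl _ => 0
      | .inr k => if y = rightEnd (.inr b) then φ (some k) • D.f (.inr (.inr k, b)) else 0 := by
  rw [col_apply, Finset.mul_sum]
  simp only [mul_smul_comm, f_dual_mul_f_grp]
  rcases a with a | a <;> rcases b with b | b <;> rcases y with _ | y <;>
    simp [h, χ_zero_left, rightEnd, ite_and]

/-- Only the barred middle indices `k̄` contribute: `v^m_k ∘ v^g_m = χ(g,k) v^m_k` and `v^m_k ∘
v^m_{k̄} = v^0_k`, so summing over `k` assembles the character. -/
theorem adjointAction_f_none (g : G) (y : Option G) (c d : G ⊕ G) :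
    WeakHopf.adjointAction D.antipode (D.f (.inl (g, none, y))) (D.f (.inr (c, d))) =
      match c, d with
      | .inr a, .inr b => if y = none ∧ b = a then
          (D.χ g a : ℂ)⁻¹ • D.col 0 (some a) (D.chiVec g) else 0
      | .inl a, .inl b => if y = some (g + a) ∧ b = g + a then
          D.col 0 none (D.chiVec g) else 0
      | _, _ => 0 := by
  rw [adjointAction_f_inr, Fintype.sum_sum_type]
  rcases c with a | a <;> rcases d with b | b <;> rcases y with _ | y <;>
    simp only [antipodeBasis, smul_mul_assoc, f_dual_mul_f_grp, reduceCtorEq, false_and, if_false,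
      smul_zero, zero_mul, Finset.sum_const_zero, zero_add, true_and, ite_mul,
      f_dual_mul_f_dual, ite_self, if_true, and_true, Option.some.injEq]
  · by_cases hy : y = g + a
    · by_cases hb : b = g + a
      · simp only [hy, hb, if_true, and_self, smul_smul, sub_self, χ_zero_left, col_apply, chiVec,
          Fintype.sum_option, zero_smul, zero_add, Circle.coe_one, mul_one]
        refine Finset.sum_congr rfl fun k _ => ?_
        -- The `τ⁻¹` of the antipode cancels the `τ` of the product.
        rw [mul_comm, mul_assoc, mul_inv_cancel₀ D.τ_ne_zero, mul_one]
      · simp [hb, eq_comm (b := b)]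
    · simp [hy]
  · by_cases hb : b = a
    · simp [hb, col_apply, chiVec, Finset.smul_sum, smul_smul, mul_comm, χ_conj]
    · simp [hb, eq_comm (a := (0 : G)), sub_eq_zero]

/-- Only the unbarred middle indices `k` contribute, through `v^m_{k̄} ∘ v^0_k = v^m_{k̄}` and
`v^m_{k̄} ∘ v^m_k = τ ∑_p χ(p,k)⁻¹ v^p_m`. With two barred indices `ā, b̄` the second factor retains
only `p = b - a`, which isolates one Fourier coefficient. -/
theorem adjointAction_col_f_inr (y : Option G) (φ : Option G → ℂ) (h : φ none = 0) (c d : G ⊕ G) :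
    WeakHopf.adjointAction D.antipode (D.col 0 y φ) (D.f (.inr (c, d))) =
      match c, d with
      | .inr a, .inr b => if y = none then
          ((D.τ : ℂ) ^ 2 * D.fourier φ (b - a)) • D.f (.inl (b - a, none, some b)) else 0
      | .inl a, .inl b => if y = some a ∧ b = a then
          ∑ p, ((D.τ : ℂ) ^ 2 * D.fourier φ p * (D.χ p a : ℂ)) • D.f (.inl (p, none, none)) else 0
      | _, _ => 0 := by
  rw [adjointAction_f_inr, Fintype.sum_sum_type]
  rcases c with a | a <;> rcases d with b | b <;> rcases y with _ | y <;>
    simp only [antipodeBasis, smul_mul_assoc, f_dual_mul_col _ _ _ h, rightEnd,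
      smul_zero, zero_mul, Finset.sum_const_zero, add_zero, ite_mul,
      f_dual_mul_f_dual, ite_self, if_true, Option.some.injEq]
  all_goals try (simp; done)
  · by_cases hy : y = a
    · by_cases hb : b = a
      · simp only [hy, hb, if_true, and_self, Finset.smul_sum, smul_smul]
        rw [Finset.sum_comm]
        refine Finset.sum_congr rfl fun p _ => ?_
        rw [← Finset.sum_smul, fourier, Finset.mul_sum, Finset.sum_mul]
        congr 1
        refine Finset.sum_congr rfl fun k _ => ?_
        ring
      · simp [hb, eq_comm (b := b)]
    · simp [hy]
  · simp only [smul_smul]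
    rw [← Finset.sum_smul, fourier, Finset.mul_sum]
    congr 1
    refine Finset.sum_congr rfl fun k _ => ?_
    ring

/-! ### The spaces `invVec` define invariant coideals -/

theorem one_mem_invVec : ∀ x : WithTop (AddSubgroup G), 1 ∈ D.invVec x 0
  | ⊤ => ⟨fun h => absurd rfl h, fun _ _ => rfl⟩
  | (_ : AddSubgroup G) => ⟨fun h => absurd rfl h, fun _ _ _ => rfl, fun _ _ => by
      simp [χ_zero_left]⟩

theorem mul_mem_invVec : ∀ (x : WithTop (AddSubgroup G)) (g h : G), ∀ φ ∈ D.invVec x g,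
    ∀ ψ ∈ D.invVec x h,
      (fun x : Option G => φ (x.map (fun k => k - h)) * ψ x) ∈ D.invVec x (g + h)
  | ⊤, g, h, φ, hφ, ψ, hψ => by
    rw [mem_invVec_top] at *
    refine ⟨fun e => ?_, fun x y => ?_⟩
    · by_cases hg : g = 0
      · have hh : h ≠ 0 := fun hh => e (by rw [hg, hh, add_zero])
        funext x
        simp [hψ.1 hh]
      · funext x
        simp [hφ.1 hg]
    · rw [hφ.2 _ (y.map _), hψ.2 x y]
  | (L : AddSubgroup G), g, h, φ, hφ, ψ, hψ => by
    rw [mem_invVec_coe] at *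
    refine ⟨fun e i => ?_, fun i l hl => ?_, fun l hl => ?_⟩
    · by_cases hg : g = 0
      · have hh : h ≠ 0 := fun hh => e (by rw [hg, hh, add_zero])
        simp [hψ.1 hh]
      · simp [hφ.1 hg]
    · have := hφ.2.1 (i - h) l hl
      simp only [Option.map_some]
      rw [hψ.2.1 i l hl, ← this, sub_add_eq_add_sub]
    · have h1 := hφ.2.2 l hl
      have h2 := hψ.2.2 l hl
      simp only [Option.map_none, D.map_add_left, Circle.coe_mul]
      calc _ = ((D.χ g l : ℂ) * φ none) * ((D.χ h l : ℂ) * ψ none) := by ring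
        _ = _ := by rw [h1, h2]

theorem star_mem_invVec : ∀ (x : WithTop (AddSubgroup G)) (g : G), ∀ φ ∈ D.invVec x g,
      (fun x : Option G => conj (φ (x.map (fun h => h + g)))) ∈ D.invVec x (-g)
  | ⊤, g, φ, hφ => by
    rw [mem_invVec_top] at *
    refine ⟨fun e => ?_, fun x y => ?_⟩
    · funext x
      simp [hφ.1 (neg_ne_zero.1 e)]
    · rw [hφ.2 _ (y.map _)]
  | (L : AddSubgroup G), g, φ, hφ => by
    rw [mem_invVec_coe] at *
    refine ⟨fun e i => ?_, fun i l hl => ?_, fun l hl => ?_⟩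
    · simp [hφ.1 (neg_ne_zero.1 e)]
    · have := hφ.2.1 (i + g) l hl
      simp only [Option.map_some]
      rw [← this, add_right_comm]
    · have h1 := congrArg conj (hφ.2.2 l hl)
      rw [map_mul, χ_conj] at h1
      simpa [χ_neg_left] using h1

/-- The quotient type coideal of index `x`, as a `*`-subalgebra. -/
def invCoideal (x : WithTop (AddSubgroup G)) : StarSubalgebra ℂ D.B :=
  D.gradedStarSubalgebra (D.invVec x) (D.one_mem_invVec x) (D.mul_mem_invVec x)
    (D.star_mem_invVec x)

theorem mem_invCoideal {x : WithTop (AddSubgroup G)} {b : D.B} :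
    b ∈ D.invCoideal x ↔ b ∈ D.graded (D.invVec x) := Iff.rfl

theorem toSubmodule_invCoideal (x : WithTop (AddSubgroup G)) :
    Subalgebra.toSubmodule (D.invCoideal x).toSubalgebra = D.graded (D.invVec x) := rfl

theorem quotientTypeCoideal_eq : ∀ x : WithTop (AddSubgroup G), D.quotientTypeCoideal x =
    Subalgebra.toSubmodule (D.invCoideal x).toSubalgebra
  | ⊤ => D.quotientTypeCoideal_top
  | (L : AddSubgroup G) => D.quotientTypeCoideal_coe L

theorem adjointAction_smul_left (r : ℂ) (b x : D.B) :
    WeakHopf.adjointAction D.antipode (r • b) x = r • WeakHopf.adjointAction D.antipode b x := by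
  suffices h : WeakHopf.adjointAction D.antipode (r • b) =
      r • WeakHopf.adjointAction D.antipode b from congrArg (fun F => F x) h
  refine D.f.ext fun i => ?_
  rcases i with ⟨h, c, d⟩ | ⟨c, d⟩
  · simp only [LinearMap.smul_apply, adjointAction_f_inl, mul_smul_comm, smul_mul_assoc,
      Finset.smul_sum]
  · simp only [LinearMap.smul_apply, adjointAction_f_inr, mul_smul_comm, smul_mul_assoc,
      Finset.smul_sum]

theorem single_none_mem_invVec {L : AddSubgroup G} {g : G} (h : ∀ l ∈ L, D.χ g l = 1) :
    Pi.single none 1 ∈ D.invVec (L : WithTop (AddSubgroup G)) g :=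
  ⟨fun _ i => by simp, fun i l _ => by simp, fun l hl => by simp [h l hl]⟩

theorem chiVec_mem_invVec {L : AddSubgroup G} {g : G} (h : ∀ l ∈ L, D.χ g l = 1) :
    D.chiVec g ∈ D.invVec (L : WithTop (AddSubgroup G)) 0 :=
  ⟨fun e => absurd rfl e, fun i l hl => by simp [chiVec, χ_add_right, h l hl],
    fun l hl => by simp [chiVec]⟩

theorem smul_single_add_update (φ : Option G → ℂ) :
    φ = φ none • Pi.single none 1 + Function.update φ none 0 := by
  funext x
  rcases x with _ | x <;> simp

theorem single_none_add_chiVec_zero : Pi.single none 1 + D.chiVec 0 = 1 := by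
  funext x
  rcases x with _ | x <;> simp [chiVec, χ_zero_left]

theorem adjointAction_f_none_mem {L : AddSubgroup G} {g : G} (h : ∀ l ∈ L, D.χ g l = 1)
    (y : Option G) (c d : G ⊕ G) :
    WeakHopf.adjointAction D.antipode (D.f (.inl (g, none, y))) (D.f (.inr (c, d))) ∈
      D.graded (D.invVec L) := by
  rw [adjointAction_f_none]
  have h' := D.chiVec_mem_invVec h
  rcases c with a | a <;> rcases d with b | b <;> simp only <;> try split_ifs
  all_goals first
    | exact Submodule.zero_mem _
    | exact Submodule.smul_mem _ _ (D.col_mem_graded.2 h')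
    | exact D.col_mem_graded.2 h'

theorem smul_f_none_mem {L : AddSubgroup G} {g : G} {r : ℂ} (y : Option G)
    (h : ∀ l ∈ L, (D.χ g l : ℂ) * r = r) :
    r • D.f (.inl (g, none, y)) ∈ D.graded (D.invVec L) := by
  rw [← col_single, ← map_smul]
  refine D.col_mem_graded.2 ⟨fun _ i => by simp, fun i l _ => by simp, fun l hl => ?_⟩
  simpa using h l hl

/-- The vectors `v^p_m` that appear are weighted by Fourier coefficients of an `L`-invariant
function, so only `p` trivial on `L` contribute. -/
theorem adjointAction_col_f_inr_mem {L : AddSubgroup G} {φ : Option G → ℂ}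
    (h : ∀ i, ∀ l ∈ L, φ (some (i + l)) = φ (some i)) (h0 : φ none = 0)
    (y : Option G) (c d : G ⊕ G) :
    WeakHopf.adjointAction D.antipode (D.col 0 y φ) (D.f (.inr (c, d))) ∈
      D.graded (D.invVec L) := by
  rw [adjointAction_col_f_inr _ _ _ h0]
  have h' : ∀ p, ∀ l ∈ L, (D.χ p l : ℂ) * D.fourier φ p = D.fourier φ p := fun p l hl =>
    D.fourier_mul_of_invariant (fun i => h i l hl) p
  rcases c with a | a <;> rcases d with b | b <;> simp only <;> try split_ifs
  all_goals first
    | exact Submodule.zero_mem _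
    | skip
  · refine Submodule.sum_mem _ fun p _ => D.smul_f_none_mem _ fun l hl => ?_
    conv_rhs => rw [← h' p l hl]
    ring
  · refine D.smul_f_none_mem _ fun l hl => ?_
    conv_rhs => rw [← h' (b - a) l hl]
    ring

/-- Write `1 = δ_m + χ(0,·)`, the character being extended by zero at `m`. The action of the `f^m`
exchanges the two summands, the factor `τ² |G|` being `1`, and so returns a multiple of the constant
vector. -/
theorem adjointAction_col_one_f_inr_mem (y : Option G) (c d : G ⊕ G) :
    WeakHopf.adjointAction D.antipode (D.col 0 y 1) (D.f (.inr (c, d))) ∈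
      D.graded (D.invVec ⊤) := by
  have hτ := D.τ_sq_mul_card
  rw [← D.single_none_add_chiVec_zero, map_add, col_single, adjointAction_add_left,
    adjointAction_f_none, adjointAction_col_f_inr _ _ _ (by rfl)]
  have h1 : ∀ z, D.f (.inl (0, none, z)) + D.col 0 z (D.chiVec 0) ∈ D.graded (D.invVec ⊤) :=
    fun z => by
      rw [← col_single, ← map_add, single_none_add_chiVec_zero]
      exact D.col_mem_graded.2 (D.one_mem_invVec ⊤)
  rcases c with a | a <;> rcases d with b | b <;>
    simp only [zero_add, add_zero, Submodule.zero_mem, fourier_chiVec, mul_ite, mul_zero, ite_mul,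
      zero_mul, ite_smul, zero_smul, hτ, χ_zero_left, Circle.coe_one, one_smul, inv_one]
  · split_ifs
    · simpa [add_comm, χ_zero_left] using h1 none
    · simp
  · by_cases hy : y = none <;> by_cases hb : b = a
    · simpa [hy, hb, add_comm] using h1 (some a)
    all_goals simp [hy, hb, sub_eq_zero]

theorem map_mem_of_forall_f {M : Submodule ℂ D.B} {F : D.B →ₗ[ℂ] D.B} (h : ∀ i, F (D.f i) ∈ M)
    (x : D.B) : F x ∈ M := by
  rw [← D.f.sum_repr x, map_sum]
  refine Submodule.sum_mem _ fun i _ => ?_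
  rw [map_smul]
  exact M.smul_mem _ (h i)

/-- This is the vector produced by `adjointAction_col_f_inl`. Translation respects invariance, and
the cut-off matters only for `g ≠ 0`, where `φ` already vanishes on `G`. -/
theorem mem_invVec_of_fixed : ∀ (x : WithTop (AddSubgroup G)) (g h : G), ∀ φ ∈ D.invVec x g,
    (fun x : Option G => if x.map (fun k => k + g) = x then φ (x.map (fun k => k - h)) else 0) ∈
      D.invVec x g
  | ⊤, g, h, φ, hφ => by
    rw [mem_invVec_top] at *
    by_cases hg : g = 0
    · subst hg
      refine ⟨fun e => absurd rfl e, fun x y => ?_⟩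
      simpa using hφ.2 _ _
    · simp [hφ.1 hg, Pi.zero_def]
  | (L : AddSubgroup G), g, h, φ, hφ => by
    rw [mem_invVec_coe] at *
    refine ⟨fun e i => by simp [e], fun i l hl => ?_, fun l hl => by simpa using hφ.2.2 l hl⟩
    have := hφ.2.1 (i - h) l hl
    simp [add_sub_right_comm, this]

theorem ite_fixed_eq : ∀ (x : WithTop (AddSubgroup G)) (g : G), ∀ φ ∈ D.invVec x g,
    (fun x : Option G => if x.map (fun k => k + g) = x then φ (x.map (fun k => k - 0)) else 0) = φ
  | ⊤, g, φ, hφ => by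
    by_cases hg : g = 0
    · simp [hg]
    · simp [hφ.1 hg, Pi.zero_def]
  | (L : AddSubgroup G), g, φ, hφ => by
    by_cases hg : g = 0
    · simp [hg]
    · funext x
      rcases x with _ | x
      · simp
      · simp [hg, hφ.1 hg]

theorem adjointAction_col_f_inr_mem_invCoideal : ∀ (x : WithTop (AddSubgroup G)) (g : G)
    (y : Option G), ∀ φ ∈ D.invVec x g, ∀ c d : G ⊕ G,
    WeakHopf.adjointAction D.antipode (D.col g y φ) (D.f (.inr (c, d))) ∈ D.graded (D.invVec x)
  | ⊤, g, y, φ, hφ, c, d => by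
    by_cases hg : g = 0
    · subst hg
      have e : φ = φ none • 1 := funext fun x => by simpa using hφ.2 x none
      rw [e, map_smul, adjointAction_smul_left]
      exact Submodule.smul_mem _ _ (D.adjointAction_col_one_f_inr_mem y c d)
    · rw [hφ.1 hg, map_zero, adjointAction_zero_left]
      exact Submodule.zero_mem _
  | (L : AddSubgroup G), g, y, φ, hφ, c, d => by
    rw [mem_invVec_coe] at hφ
    -- Split `φ` into its value at `m` and its restriction to `G`, on which the `f^m` act by the two
    -- different formulas. If the value at `m` is nonzero it can be cancelled, and `χ(g,·)` is
    -- trivial on `L`.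
    rw [smul_single_add_update φ, map_add, map_smul, col_single, adjointAction_add_left,
      adjointAction_smul_left]
    refine Submodule.add_mem _ ?_ ?_
    · by_cases h0 : φ none = 0
      · rw [h0, zero_smul]
        exact Submodule.zero_mem _
      · refine Submodule.smul_mem _ _ (D.adjointAction_f_none_mem (fun l hl => ?_) y c d)
        exact Circle.ext (by simpa using mul_right_cancel₀ h0 ((hφ.2.2 l hl).trans (one_mul _).symm))
    · by_cases hg : g = 0
      · subst hg
        exact D.adjointAction_col_f_inr_mem (fun i l hl => by simpa using hφ.2.1 i l hl)
          (by simp) y c d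
      · have e : Function.update φ none 0 = 0 := by
          funext x
          rcases x with _ | x <;> simp [hφ.1 hg]
        rw [e, map_zero, adjointAction_zero_left]
        exact Submodule.zero_mem _

theorem isInvariantCoideal_invCoideal (x : WithTop (AddSubgroup G)) :
    WeakHopf.IsInvariantCoideal D.antipode (D.invCoideal x) := by
  refine ⟨D.isCoideal_of_toSubmodule_eq_graded (D.toSubmodule_invCoideal x), ?_⟩
  rw [toSubmodule_invCoideal]
  apply le_antisymm
  · rw [Submodule.span_le]
    rintro _ ⟨b, hb, z, rfl⟩
    refine D.graded_induction (p := fun b => WeakHopf.adjointAction D.antipode b z ∈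
      D.graded (D.invVec x)) (fun g y φ hφ => ?_)
      (fun a b ha hb => by rw [adjointAction_add_left]; exact Submodule.add_mem _ ha hb)
      (by rw [adjointAction_zero_left]; exact Submodule.zero_mem _) (D.mem_invCoideal.1 hb)
    refine D.map_mem_of_forall_f (fun i => ?_) z
    rcases i with ⟨h, c, d⟩ | ⟨c, d⟩
    · rw [adjointAction_col_f_inl]
      split_ifs
      · exact D.col_mem_graded.2 (D.mem_invVec_of_fixed x g h φ hφ)
      · exact Submodule.zero_mem _
    · exact D.adjointAction_col_f_inr_mem_invCoideal x g y φ hφ c d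
  · intro b hb
    refine D.graded_induction (p := fun b => b ∈ Submodule.span ℂ {y : D.B | ∃ b ∈ D.invCoideal x,
      ∃ x : D.B, y = WeakHopf.adjointAction D.antipode b x}) (fun g y φ hφ => ?_)
      (fun a b ha hb => Submodule.add_mem _ ha hb) (Submodule.zero_mem _) hb
    -- Each column is its own image under the action of `f^0_{y-g,y}`: there is no translation, and
    -- the cut-off does not affect vectors of `invVec`.
    refine Submodule.subset_span ⟨D.col g y φ, D.mem_invCoideal.2 (D.col_mem_graded.2 hφ),
      D.f (.inl (0, y.map (fun k => k + 0 - g), y)), ?_⟩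
    rw [adjointAction_col_f_inl, if_pos (by simp), D.ite_fixed_eq x g φ hφ]

/-! ### Annihilators -/

/-- The annihilator of a subgroup with respect to the bicharacter. -/
def ann (L : AddSubgroup G) : AddSubgroup G where
  carrier := {g | ∀ l ∈ L, D.χ g l = 1}
  add_mem' ha hb l hl := by rw [D.map_add_left, ha l hl, hb l hl, one_mul]
  zero_mem' _ _ := D.χ_zero_left _
  neg_mem' ha l hl := by rw [χ_neg_left, ha l hl, inv_one]

theorem mem_ann {L : AddSubgroup G} {g : G} : g ∈ D.ann L ↔ ∀ l ∈ L, D.χ g l = 1 := Iff.rfl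

theorem ann_antitone {L K : AddSubgroup G} (h : L ≤ K) : D.ann K ≤ D.ann L :=
  fun _ hg l hl => hg l (h hl)

theorem sum_χ_subgroup (L : AddSubgroup G) [DecidablePred (· ∈ L)] [DecidablePred (· ∈ D.ann L)]
    (g : G) : ∑ l : L, (D.χ g l : ℂ) = if g ∈ D.ann L then (Fintype.card L : ℂ) else 0 := by
  split_ifs with h
  · simp [h _ (SetLike.coe_mem _)]
  · rw [mem_ann] at h
    push Not at h
    obtain ⟨b, hb, hne⟩ := h
    have e : (D.χ g b : ℂ) * ∑ l : L, (D.χ g l : ℂ) = ∑ l : L, (D.χ g l : ℂ) := by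
      rw [Finset.mul_sum]
      refine Fintype.sum_equiv (Equiv.addLeft (⟨b, hb⟩ : L)) _ _ fun l => ?_
      simp [χ_add_right]
    by_contra H
    exact hne (Circle.ext (by simpa using mul_right_cancel₀ H (e.trans (one_mul _).symm)))

/-- If `a` kills `ann L` but is not in `L`, evaluate `∑_g ∑_l χ(g, l - a)` twice. Summing over `g`
first gives `0`, as `l ≠ a`; summing over `l` first gives `|L| |ann L|`. -/
theorem ann_ann (L : AddSubgroup G) : D.ann (D.ann L) = L := by
  classical
  apply le_antisymm
  · intro a ha
    by_contra haL
    have h1 : ∑ g : G, ∑ l : L, (D.χ g (l - a) : ℂ) = 0 := by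
      rw [Finset.sum_comm]
      refine Finset.sum_eq_zero fun l _ => ?_
      rw [sum_χ, if_neg]
      intro e
      exact haL (by rw [← sub_eq_zero.1 e]; exact l.2)
    have h2 : ∀ g : G, ∑ l : L, (D.χ g (l - a) : ℂ) =
        if g ∈ D.ann L then (Fintype.card L : ℂ) else 0 := by
      intro g
      simp only [χ_sub_right, Circle.coe_mul, ← Finset.sum_mul, sum_χ_subgroup]
      split_ifs with hg
      · rw [D.symm, ha g hg]
        simp
      · simp
    simp only [h2, Finset.sum_ite, Finset.sum_const_zero, add_zero, Finset.sum_const,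
      nsmul_eq_mul, mul_eq_zero, Nat.cast_eq_zero, Finset.card_eq_zero,
      Fintype.card_ne_zero, or_false] at h1
    exact Finset.ne_empty_of_mem (a := (0 : G)) (by simp [(D.ann L).zero_mem]) h1
  · intro l hl g hg
    rw [D.symm]
    exact hg l hl

/-- By biduality, whatever annihilates `ann L + ann K` lies in both `L` and `K`. This supplies the
vectors at `m` for the join of two coideals. -/
theorem ann_inf_le (L K : AddSubgroup G) : D.ann (L ⊓ K) ≤ D.ann L ⊔ D.ann K := by
  rw [← D.ann_ann (D.ann L ⊔ D.ann K)]
  refine D.ann_antitone (le_inf ?_ ?_)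
  · exact (D.ann_antitone le_sup_left).trans (D.ann_ann L).le
  · exact (D.ann_antitone le_sup_right).trans (D.ann_ann K).le

/-! ### Classification of the invariant coideals -/

/-- The algebra of the functions `φ` on `G ⊔ {m}` such that `φ ⊗ conj(v^0_y)` belongs to `J`. -/
def vecAlgebra (J : StarSubalgebra ℂ D.B) (y : Option G) (h : D.col 0 y 1 ∈ J) :
    Subalgebra ℂ (Option G → ℂ) :=
  (J.toSubalgebra.toSubmodule.comap (D.col 0 y)).toSubalgebra h (by
    intro φ ψ hφ hψ
    have e : D.col 0 y φ * D.col 0 y ψ = D.col 0 y (φ * ψ) := by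
      rw [col_mul_col, if_pos (by simp), add_zero]
      congr 1
      funext x
      simp
    change D.col 0 y (φ * ψ) ∈ J
    rw [← e]
    exact J.mul_mem hφ hψ)

/-- Apply the coordinate functional at `f^g_{z,y}` to the second leg of `Δ(b) ∈ J ⊗ B`. A coideal
thus contains each group-indexed column of its elements, moved to any index `z`. -/
theorem col_mem_of_mem {J : StarSubalgebra ℂ D.B} (hJ : WeakHopf.IsCoideal J) {b : D.B}
    (hb : b ∈ J) (g : G) (y z : Option G) : D.col g z (fun x => b (.inl (g, x, y))) ∈ J := by
  have h := D.slice_comul_inl LinearMap.id b g z y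
  simp only [TensorProduct.map_id, LinearMap.id_apply] at h
  rw [col_apply, ← h]
  obtain ⟨t, ht⟩ := hJ b hb
  rw [← ht]
  clear ht h
  induction t with
  | zero => simp
  | add s t hs ht => rw [map_add, map_add]; exact J.add_mem hs ht
  | tmul c d =>
    rw [TensorProduct.map_tmul, slice_tmul]
    exact J.smul_mem c.2 _

theorem col_mem_of_col_mem {J : StarSubalgebra ℂ D.B} (hJ : WeakHopf.IsCoideal J) {g : G}
    {φ : Option G → ℂ} {y : Option G} (h : D.col g y φ ∈ J) (z : Option G) :
    D.col g z φ ∈ J := by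
  simpa [col_coord_inl] using D.col_mem_of_mem hJ h g y z

theorem col_one_mem {J : StarSubalgebra ℂ D.B} (hJ : WeakHopf.IsCoideal J) (y : Option G) :
    D.col 0 y 1 ∈ J := by
  have h := D.col_mem_of_mem hJ J.one_mem 0 y y
  convert h using 2
  funext x
  rw [one_eq_sum_col, sum_apply]
  simp [col_coord_inl, -Fintype.sum_option]

theorem adjointAction_mem {J : StarSubalgebra ℂ D.B}
    (hJ : WeakHopf.IsInvariantCoideal D.antipode J) {b : D.B} (hb : b ∈ J) (x : D.B) :
    WeakHopf.adjointAction D.antipode b x ∈ J := by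
  have : WeakHopf.adjointAction D.antipode b x ∈ Subalgebra.toSubmodule J.toSubalgebra :=
    hJ.2 ▸ Submodule.subset_span ⟨b, hb, x, rfl⟩
  exact this

/-- Here the inclusion `J ⊆ J ◁ B` matters: every element of `J` is a combination of values of the
adjoint action, which are supported where the two ends agree. -/
theorem apply_eq_zero_of_mem {J : StarSubalgebra ℂ D.B}
    (hJ : WeakHopf.IsInvariantCoideal D.antipode J) {b : D.B} (hb : b ∈ J) {k : BIdx G}
    (hk : leftEnd (BIdx.left k) ≠ rightEnd (BIdx.left k)) : b k = 0 := by
  have hb' : b ∈ Subalgebra.toSubmodule J.toSubalgebra := hb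
  rw [← hJ.2] at hb'
  clear hb
  induction hb' using Submodule.span_induction with
  | mem x h => obtain ⟨b, _, x, rfl⟩ := h; exact D.adjointAction_apply_eq_zero b x hk
  | zero => rfl
  | add x y _ _ hx hy => rw [add_apply, hx, hy, add_zero]
  | smul r x _ hx => rw [smul_apply, hx, mul_zero]

theorem apply_inr_eq_zero {J : StarSubalgebra ℂ D.B}
    (hJ : WeakHopf.IsInvariantCoideal D.antipode J) {b : D.B} (hb : b ∈ J) (p : (G ⊕ G) × (G ⊕ G)) : b (.inr p) = 0 :=
  D.apply_eq_zero_of_mem hJ hb (by rcases p with ⟨a | a, c⟩ <;> simp [leftEnd, rightEnd, BIdx.left])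

theorem apply_some_eq_zero {J : StarSubalgebra ℂ D.B}
    (hJ : WeakHopf.IsInvariantCoideal D.antipode J) {g : G} (hg : g ≠ 0) {y : Option G} {φ : Option G → ℂ}
    (h : D.col g y φ ∈ J) (i : G) : φ (some i) = 0 := by
  have := D.apply_eq_zero_of_mem hJ h (k := .inl (g, some i, y))
    (by simp [leftEnd, rightEnd, BIdx.left, hg])
  simpa [col_coord_inl] using this

theorem eq_smul_single_none {J : StarSubalgebra ℂ D.B}
    (hJ : WeakHopf.IsInvariantCoideal D.antipode J) {g : G} (hg : g ≠ 0) {y : Option G} {φ : Option G → ℂ}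
    (h : D.col g y φ ∈ J) : φ = φ none • Pi.single none 1 := by
  funext x
  rcases x with _ | x
  · simp
  · simp [D.apply_some_eq_zero hJ hg h]

theorem f_none_mem_of_ne_zero {J : StarSubalgebra ℂ D.B}
    (hJ : WeakHopf.IsInvariantCoideal D.antipode J) {g : G} (hg : g ≠ 0) {y : Option G} {φ : Option G → ℂ}
    (h : D.col g y φ ∈ J) (h0 : φ none ≠ 0) : D.f (.inl (g, none, y)) ∈ J := by
  have e := D.eq_smul_single_none hJ hg h
  rw [e, map_smul, col_single] at h
  have := J.smul_mem h (φ none)⁻¹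
  rwa [smul_smul, inv_mul_cancel₀ h0, one_smul] at this

theorem translate_mem {J : StarSubalgebra ℂ D.B}
    (hJ : WeakHopf.IsInvariantCoideal D.antipode J) {φ : Option G → ℂ} {y : Option G} (h : D.col 0 y φ ∈ J) (k : G)
    (z : Option G) : D.col 0 z (fun x => φ (x.map (fun i => i - k))) ∈ J := by
  have := D.adjointAction_mem hJ h
    (D.f (.inl (k, y.map (fun i => i + k - 0), y.map (fun i => i + k))))
  rw [adjointAction_col_f_inl, if_pos ⟨rfl, rfl⟩] at this
  simp only [add_zero, Option.map_id', if_true] at this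
  exact D.col_mem_of_col_mem hJ.1 this z

theorem chiVec_mem {J : StarSubalgebra ℂ D.B}
    (hJ : WeakHopf.IsInvariantCoideal D.antipode J) {g : G} (h : D.f (.inl (g, none, none)) ∈ J) (z : Option G) :
    D.col 0 z (D.chiVec g) ∈ J := by
  -- The indices `0̄, 0̄` make the scalar `χ(g,0)⁻¹` equal to `1`.
  have := D.adjointAction_mem hJ h (D.f (.inr (.inr 0, .inr 0)))
  rw [adjointAction_f_none] at this
  simp only [and_self, if_true, χ_zero_right, Circle.coe_one, inv_one, one_smul] at this
  exact D.col_mem_of_col_mem hJ.1 this z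

theorem f_none_mem {J : StarSubalgebra ℂ D.B}
    (hJ : WeakHopf.IsInvariantCoideal D.antipode J) {g : G} (h : D.col 0 none (D.chiVec g) ∈ J) (z : Option G) :
    D.f (.inl (g, none, z)) ∈ J := by
  -- The indices `0̄, ḡ` pick the Fourier coefficient at `g`, which is `|G|` for `χ(g,·)` and is
  -- normalized by `τ²`.
  have := D.adjointAction_mem hJ h (D.f (.inr (.inr 0, .inr g)))
  rw [adjointAction_col_f_inr _ _ _ rfl] at this
  simp only [if_true, sub_zero, fourier_chiVec, τ_sq_mul_card, one_smul] at this
  rw [← col_single] at this ⊢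
  exact D.col_mem_of_col_mem hJ.1 this z

/-- There is no part in `H^m`, and columns may be moved freely between second indices, so comparing
the vectors at the single index `m` suffices. -/
theorem eq_invCoideal {J : StarSubalgebra ℂ D.B}
    (hJ : WeakHopf.IsInvariantCoideal D.antipode J) {x : WithTop (AddSubgroup G)}
    (h : ∀ g φ, D.col g none φ ∈ J ↔ φ ∈ D.invVec x g) : J = D.invCoideal x := by
  ext b
  rw [mem_invCoideal]
  constructor
  · exact fun hb => ⟨fun p => D.apply_inr_eq_zero hJ hb p,
      fun g y => (h g _).1 (D.col_mem_of_mem hJ.1 hb g y none)⟩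
  · intro hb
    exact D.graded_induction (p := fun b => b ∈ J)
      (fun g y φ hφ => D.col_mem_of_col_mem hJ.1 ((h g φ).2 hφ) y)
      (fun a b ha hb => J.add_mem ha hb) J.zero_mem hb

theorem exists_eq_invCoideal {J : StarSubalgebra ℂ D.B}
    (hJ : WeakHopf.IsInvariantCoideal D.antipode J) :
    ∃ x, J = D.invCoideal x := by
  set A := D.vecAlgebra J none (D.col_one_mem hJ.1 none) with hA
  have htr : ∀ φ ∈ A, ∀ k, (fun x : Option G => φ (x.map (fun i => i - k))) ∈ A :=
    fun φ hφ k => D.translate_mem hJ hφ k none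
  by_cases hc : ∀ φ ∈ A, ∀ x y, φ x = φ y
  · refine ⟨⊤, D.eq_invCoideal hJ fun g φ => ?_⟩
    rw [mem_invVec_top]
    by_cases hg : g = 0
    · subst hg
      refine ⟨fun h => ⟨fun e => absurd rfl e, hc φ h⟩, fun h => ?_⟩
      have e : φ = φ none • 1 := funext fun x => by simpa using h.2 x none
      rw [e]
      exact A.smul_mem A.one_mem _
    · constructor
      · intro h
        have h0 : φ none = 0 := by
          by_contra h0
          -- The character is `0` at `m` and `1` at `0`, hence not constant.
          have := hc _ (D.chiVec_mem hJ (D.f_none_mem_of_ne_zero hJ hg h h0) none) none (some 0)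
          simp [chiVec, χ_zero_right] at this
        have e : φ = 0 := by rw [D.eq_smul_single_none hJ hg h, h0, zero_smul]
        simp [e]
      · intro h
        rw [h.1 hg, map_zero]
        exact J.zero_mem
  -- `L` is the group of common periods of the functions of `A` on `G`.
  · let L : AddSubgroup G :=
      { carrier := {l | ∀ φ ∈ A, ∀ i, φ (some (i + l)) = φ (some i)}
        add_mem' := fun ha hb φ hφ i => by rw [← add_assoc, hb φ hφ, ha φ hφ]
        zero_mem' := fun φ _ i => by rw [add_zero]
        neg_mem' := fun {a} ha φ hφ i => by
          have := ha φ hφ (i + -a)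
          rwa [neg_add_cancel_right, eq_comm] at this }
    have hL : ∀ ψ : Option G → ℂ, (∀ i, ∀ l ∈ L, ψ (some (i + l)) = ψ (some i)) → ψ ∈ A := by
      intro ψ hψ
      -- If `m` were not separated from one `i`, translations, which fix `m`, would extend this to
      -- every point of `G`, and `A` would be constant.
      have hsome : ∀ i, ¬ ∀ φ ∈ A, φ none = φ (some i) := by
        intro i hi
        have hi' : ∀ φ ∈ A, ∀ j, φ none = φ (some j) := fun φ hφ j => by
          simpa using hi _ (htr φ hφ (i - j))
        refine hc fun φ hφ x y => ?_
        rcases x with _ | x <;> rcases y with _ | y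
        · rfl
        · exact hi' φ hφ y
        · exact (hi' φ hφ x).symm
        · exact (hi' φ hφ x).symm.trans (hi' φ hφ y)
      refine A.mem_of_forall_not_separated fun x y hxy => ?_
      rcases x with _ | x <;> rcases y with _ | y
      · rfl
      · exact absurd hxy (hsome y)
      · exact absurd (fun φ hφ => (hxy φ hφ).symm) (hsome x)
      -- Translating by `x - i` moves the pair `(x, y)` to `(i, i + (y - x))`, so non-separation of
      -- one pair makes `y - x` a period everywhere.
      · have hl : y - x ∈ L := fun φ hφ i => by
          have := hxy _ (htr φ hφ (x - i))
          simp only [Option.map_some] at this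
          rw [show i + (y - x) = y - (x - i) by abel, ← this, sub_sub_cancel]
        have := hψ x _ hl
        rw [← this, add_sub_cancel]
    refine ⟨L, D.eq_invCoideal hJ fun g φ => ?_⟩
    rw [mem_invVec_coe]
    by_cases hg : g = 0
    · subst hg
      refine ⟨fun h => ⟨fun e => absurd rfl e, fun i l hl => hl φ h i, fun l _ => ?_⟩,
        fun h => hL φ h.2.1⟩
      simp [χ_zero_left]
    · constructor
      · intro h
        have hs := D.apply_some_eq_zero hJ hg h
        refine ⟨fun _ => hs, fun i l _ => by rw [hs, hs], fun l hl => ?_⟩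
        by_cases h0 : φ none = 0
        · rw [h0, mul_zero]
        -- Periodicity of the character, read at `0`, says `χ(g,l) = χ(g,0) = 1`.
        · have := hl _ (D.chiVec_mem hJ (D.f_none_mem_of_ne_zero hJ hg h h0) none) 0
          simp only [chiVec, χ_zero_right, zero_add, Circle.coe_one] at this
          rw [this, one_mul]
      · rintro ⟨h1, -, h3⟩
        have e : φ = φ none • Pi.single none 1 := by
          funext x
          rcases x with _ | x
          · simp
          · simp [h1 hg]
        by_cases h0 : φ none = 0
        · rw [e, h0, zero_smul, map_zero]
          exact J.zero_mem
        · rw [e, map_smul, col_single]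
          refine J.smul_mem (D.f_none_mem hJ (hL _ fun i l hl => ?_) none) _
          have : (D.χ g l : ℂ) = 1 := mul_right_cancel₀ h0 ((h3 l hl).trans (one_mul _).symm)
          simp [chiVec, χ_add_right, this]


/-! ### The lattice of the invariant coideals -/

theorem invCoideal_le_of_forall {x : WithTop (AddSubgroup G)} {J : StarSubalgebra ℂ D.B}
    (h : ∀ g y, ∀ φ ∈ D.invVec x g, D.col g y φ ∈ J) : D.invCoideal x ≤ J := fun _ hb =>
  D.graded_induction (p := fun b => b ∈ J) h (fun _ _ ha hb => J.add_mem ha hb) J.zero_mem hb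

theorem col_mem_invCoideal {x : WithTop (AddSubgroup G)} {g : G} {y : Option G}
    {φ : Option G → ℂ} : D.col g y φ ∈ D.invCoideal x ↔ φ ∈ D.invVec x g :=
  D.col_mem_graded

theorem invCoideal_le_iff {x y : WithTop (AddSubgroup G)} :
    D.invCoideal x ≤ D.invCoideal y ↔ ∀ g, D.invVec x g ≤ D.invVec y g :=
  ⟨fun h _ _ hφ => D.col_mem_invCoideal.1 (h (D.col_mem_invCoideal (y := none).2 hφ)),
    fun h => D.invCoideal_le_of_forall fun g _ _ hφ => D.col_mem_invCoideal.2 (h g hφ)⟩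

/-- The indicator function of a translate of a subgroup `L` of `G`. -/
theorem indicator_mem_invVec (L : AddSubgroup G) [DecidablePred (· ∈ L)] (i : G) :
    (fun x : Option G => x.elim 0 fun j => if j - i ∈ L then 1 else 0) ∈
      D.invVec (L : WithTop (AddSubgroup G)) 0 := by
  refine ⟨fun e => absurd rfl e, fun j l hl => ?_, fun l hl => by simp⟩
  simp [add_sub_right_comm, L.add_mem_cancel_right hl]

theorem invCoideal_le_invCoideal_iff : ∀ {x y : WithTop (AddSubgroup G)},
    D.invCoideal x ≤ D.invCoideal y ↔ y ≤ x
  | ⊤, ⊤ => by simp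
  | ⊤, (K : AddSubgroup G) => by
    simp only [le_top, iff_true, invCoideal_le_iff]
    intro g φ hφ
    rw [mem_invVec_top] at hφ
    by_cases hg : g = 0
    · subst hg
      exact ⟨fun e => absurd rfl e, fun _ _ _ => hφ.2 _ _, fun _ _ => by simp [χ_zero_left]⟩
    · rw [hφ.1 hg]
      exact Submodule.zero_mem _
  | (L : AddSubgroup G), ⊤ => by
    simp only [top_le_iff, WithTop.coe_ne_top, iff_false]
    intro h
    -- The indicator of `m` is fixed by every subgroup but is not constant.
    have := (D.mem_invVec_top.1 (D.invCoideal_le_iff.1 h 0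
      (D.single_none_mem_invVec fun l _ => D.χ_zero_left l))).2 none (some 0)
    simp at this
  | (L : AddSubgroup G), (K : AddSubgroup G) => by
    classical
    rw [WithTop.coe_le_coe, invCoideal_le_iff]
    constructor
    · intro h k hk
      -- The indicator of `L` must be `K`-invariant; comparing its values at `0` and `k` gives `k ∈
      -- L`.
      have := (D.mem_invVec_coe.1 (h 0 (D.indicator_mem_invVec L 0))).2.1 0 k hk
      by_contra hkL
      simp [hkL, L.zero_mem] at this
    · intro h g φ hφ
      exact ⟨hφ.1, fun i l hl => hφ.2.1 i l (h hl), fun l hl => hφ.2.2 l (h hl)⟩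

theorem invCoideal_coe_sup (L K : AddSubgroup G) :
    D.invCoideal ((L ⊔ K : AddSubgroup G) : WithTop (AddSubgroup G)) =
      D.invCoideal L ⊓ D.invCoideal K := by
  apply le_antisymm
  · exact le_inf (D.invCoideal_le_invCoideal_iff.2 (WithTop.coe_le_coe.2 le_sup_left))
      (D.invCoideal_le_invCoideal_iff.2 (WithTop.coe_le_coe.2 le_sup_right))
  · rintro b ⟨hL, hK⟩
    refine ⟨hL.1, fun g y => ⟨(hL.2 g y).1, fun i l hl => ?_, fun l hl => ?_⟩⟩
    · obtain ⟨a, ha, c, hc, rfl⟩ := AddSubgroup.mem_sup.1 hl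
      rw [← add_assoc]
      exact ((hK.2 g y).2.1 (i + a) c hc).trans ((hL.2 g y).2.1 i a ha)
    · obtain ⟨a, ha, c, hc, rfl⟩ := AddSubgroup.mem_sup.1 hl
      have h1 := (hL.2 g y).2.2 a ha
      have h2 := (hK.2 g y).2.2 c hc
      rw [χ_add_right, Circle.coe_mul, mul_assoc, h2, h1]

theorem invCoideal_coe_inf (L K : AddSubgroup G) :
    D.invCoideal ((L ⊓ K : AddSubgroup G) : WithTop (AddSubgroup G)) =
      D.invCoideal L ⊔ D.invCoideal K := by
  classical
  apply le_antisymm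
  swap
  · exact sup_le (D.invCoideal_le_invCoideal_iff.2 (WithTop.coe_le_coe.2 inf_le_left))
      (D.invCoideal_le_invCoideal_iff.2 (WithTop.coe_le_coe.2 inf_le_right))
  set J := D.invCoideal L ⊔ D.invCoideal K
  have hLJ : D.invCoideal L ≤ J := le_sup_left
  have hKJ : D.invCoideal K ≤ J := le_sup_right
  refine D.invCoideal_le_of_forall fun g y φ hφ => ?_
  rw [mem_invVec_coe] at hφ
  rw [smul_single_add_update φ, map_add, map_smul, col_single]
  refine J.add_mem ?_ ?_
  · by_cases h0 : φ none = 0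
    · rw [h0, zero_smul]
      exact J.zero_mem
    · refine J.smul_mem ?_ _
      have hg : g ∈ D.ann (L ⊓ K) := fun l hl =>
        Circle.ext (by simpa using mul_right_cancel₀ h0 ((hφ.2.2 l hl).trans (one_mul _).symm))
      -- Write `g = a + c` with `a` trivial on `L` and `c` trivial on `K`; then `v^a_m ∘ v^c_m =
      -- v^g_m`. The index `y - c` is the one that makes the second factors composable.
      obtain ⟨a, ha, c, hc, rfl⟩ := AddSubgroup.mem_sup.1 (D.ann_inf_le L K hg)
      have e : D.f (.inl (a, none, y.map fun k => k - c)) * D.f (.inl (c, none, y)) =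
          D.f (.inl (a + c, none, y)) := by
        rw [f_grp_mul_f_grp, if_pos]
        rcases y with _ | y <;> simp
      rw [← e, ← col_single, ← col_single]
      exact J.mul_mem (hLJ (D.col_mem_invCoideal.2 (D.single_none_mem_invVec ha)))
        (hKJ (D.col_mem_invCoideal.2 (D.single_none_mem_invVec hc)))
  · by_cases hg : g = 0
    · subst hg
      have h1 : D.col 0 y 1 ∈ J := hLJ (D.col_mem_invCoideal.2 (D.one_mem_invVec L))
      change _ ∈ D.vecAlgebra J y h1
      have hn : Pi.single none 1 ∈ D.vecAlgebra J y h1 := hLJ (D.col_mem_invCoideal.2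
        (D.single_none_mem_invVec fun l _ => D.χ_zero_left l))
      -- The indicator of `m` separates `m` from `G`, and the indicators of cosets of `L` and of `K`
      -- separate points of `G` unless they are congruent modulo `L ∩ K`.
      refine Subalgebra.mem_of_forall_not_separated _ fun i j hij => ?_
      rcases i with _ | i <;> rcases j with _ | j
      · rfl
      · simpa using hij _ hn
      · simpa using hij _ hn
      · have hjL : j - i ∈ L := by
          by_contra hne
          simpa [hne, L.zero_mem] using
            hij _ (hLJ (D.col_mem_invCoideal.2 (D.indicator_mem_invVec L i)))
        have hjK : j - i ∈ K := by
          by_contra hne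
          simpa [hne, K.zero_mem] using
            hij _ (hKJ (D.col_mem_invCoideal.2 (D.indicator_mem_invVec K i)))
        have := hφ.2.1 i _ ⟨hjL, hjK⟩
        simpa [eq_comm] using this
    · have e : Function.update φ none 0 = 0 := by
        funext x
        rcases x with _ | x <;> simp [hφ.1 hg]
      rw [e, map_zero]
      exact J.zero_mem

theorem invCoideal_sup : ∀ x y : WithTop (AddSubgroup G),
    D.invCoideal (x ⊔ y) = D.invCoideal x ⊓ D.invCoideal y
  | ⊤, y => by
    rw [top_sup_eq, inf_eq_left.2 (D.invCoideal_le_invCoideal_iff.2 le_top)]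
  | x, ⊤ => by
    rw [sup_top_eq, inf_eq_right.2 (D.invCoideal_le_invCoideal_iff.2 le_top)]
  | (L : AddSubgroup G), (K : AddSubgroup G) => D.invCoideal_coe_sup L K

theorem invCoideal_inf : ∀ x y : WithTop (AddSubgroup G),
    D.invCoideal (x ⊓ y) = D.invCoideal x ⊔ D.invCoideal y
  | ⊤, y => by
    rw [top_inf_eq, sup_eq_right.2 (D.invCoideal_le_invCoideal_iff.2 le_top)]
  | x, ⊤ => by
    rw [inf_top_eq, sup_eq_left.2 (D.invCoideal_le_invCoideal_iff.2 le_top)]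
  | (L : AddSubgroup G), (K : AddSubgroup G) => D.invCoideal_coe_inf L K

/-- The lattice of the invariant coideals of `B`. -/
def invariantCoideals : Sublattice (StarSubalgebra ℂ D.B) where
  carrier := {J | WeakHopf.IsInvariantCoideal D.antipode J}
  supClosed' := by
    intro I hI J hJ
    -- Invariance of the generated algebra is not checked directly: by the classification it is
    -- again one of the `invCoideal`s.
    obtain ⟨x, rfl⟩ := D.exists_eq_invCoideal hI
    obtain ⟨y, rfl⟩ := D.exists_eq_invCoideal hJ
    rw [← invCoideal_inf]
    exact D.isInvariantCoideal_invCoideal _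
  infClosed' := by
    intro I hI J hJ
    obtain ⟨x, rfl⟩ := D.exists_eq_invCoideal hI
    obtain ⟨y, rfl⟩ := D.exists_eq_invCoideal hJ
    rw [← invCoideal_sup]
    exact D.isInvariantCoideal_invCoideal _

/-- The anti-isomorphism of the completed lattice of subgroups of `G` onto the lattice of the
invariant coideals. -/
def invCoidealOrderIso : WithTop (AddSubgroup G) ≃o (D.invariantCoideals)ᵒᵈ where
  toEquiv := Equiv.ofBijective
    (fun x => OrderDual.toDual ⟨D.invCoideal x, D.isInvariantCoideal_invCoideal x⟩)
    ⟨fun x y h => by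
      have h' : D.invCoideal x = D.invCoideal y :=
        congrArg (fun z => (OrderDual.ofDual z).1) h
      exact le_antisymm (D.invCoideal_le_invCoideal_iff.1 h'.ge)
        (D.invCoideal_le_invCoideal_iff.1 h'.le),
    fun J => by
      obtain ⟨x, hx⟩ := D.exists_eq_invCoideal (OrderDual.ofDual J).2
      exact ⟨x, congrArg OrderDual.toDual (Subtype.ext hx.symm)⟩⟩
  map_rel_iff' := D.invCoideal_le_invCoideal_iff

end Datum
end TambaraYamagami
end

/-! ### The anti-isomorphism and the two lattice identities -/

theorem proposition5p9 {G : Type*} [AddCommGroup G] [Fintype G] [DecidableEq G]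
    (D : TambaraYamagami.Datum G) :
    ∃ 𝓛 : Sublattice (StarSubalgebra ℂ D.B),
      (∀ J : StarSubalgebra ℂ D.B, J ∈ 𝓛 ↔ WeakHopf.IsInvariantCoideal D.antipode J) ∧
      (∃ Φ : WithTop (AddSubgroup G) ≃o (𝓛)ᵒᵈ, ∀ x : WithTop (AddSubgroup G),
        Subalgebra.toSubmodule (OrderDual.ofDual (Φ x)).1.toSubalgebra =
          D.quotientTypeCoideal x) ∧
      ∀ L K : AddSubgroup G,
        D.quotientTypeCoideal ((L ⊔ K : AddSubgroup G) : WithTop (AddSubgroup G)) =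
            D.quotientTypeCoideal L ⊓ D.quotientTypeCoideal K ∧
          D.quotientTypeCoideal ((L ⊓ K : AddSubgroup G) : WithTop (AddSubgroup G)) =
            Subalgebra.toSubmodule (StarAlgebra.adjoin ℂ
              ((D.quotientTypeCoideal L : Set D.B) ∪
                (D.quotientTypeCoideal K : Set D.B))).toSubalgebra := by
  refine ⟨D.invariantCoideals, fun J => Iff.rfl,
    ⟨D.invCoidealOrderIso, fun x => (D.quotientTypeCoideal_eq x).symm⟩, fun L K => ⟨?_, ?_⟩⟩
  · simp only [D.quotientTypeCoideal_eq, D.invCoideal_coe_sup]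
    rfl
  -- The supremum of two star subalgebras is by definition generated by their union, so the
  -- remaining equality is definitional.
  · simp only [D.quotientTypeCoideal_eq, D.invCoideal_coe_inf]
    rfl
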